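/- Conventions. A metric-measure space $X=(X,d,\mu)$ is a compact metric space $(X,d)$ with a finite Borel measure $\mu$; $B_r(x)=\{y: d(x,y)<r\}$. For $\rho>0$ the $\rho$-Laplacian is the bounded operator on $L^2(X,\mu)$ given, for $\mu$-almost every $x$, by $$\Delta^\rho_X u(x)=\frac{1}{\rho^2\mu(B_\rho(x))}\int_{B_\rho(x)}\bigl(u(x)-u(y)\bigr)\,d\mu(y).$$ Its spectrum is real. The discrete spectrum consists of the isolated points of the spectrum that are eigenvalues of finite multiplicity; the essential spectrum is the rest of the spectrum. Let $\lambda_\infty(X,\rho)$ be the infimum of the essential spectrum ($+\infty$ if it is empty). For $k\ge 1$ let $\lambda_k(X,\rho)\in[0,+\infty]$ be the $k$-th smallest, counted with multiplicity, of the eigenvalues of $\Delta^\rho_X$ smaller than $\lambda_\infty(X,\rho)$, and put $\lambda_k(X,\rho)=\lambda_\infty(X,\rho)$ if there are fewer than $k$ such eigenvalues. A sequence $X_n=(X_n,d_n,\mu_n)$ of metric-measure spaces converges to $X=(X,d,\mu)$ in the sense of Fukaya if there are positive numbers $\sigma_n\to 0$ and measurable maps $f_n\colon X_n\to X$ such that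 (1) for each $n$, every point of $X$ is within distance $\sigma_n$ of some point of $f_n(X_n)$; (2) $|d(f_n(x),f_n(y))-d_n(x,y)|<\sigma_n$ for all $x,y\in X_n$; (3) the push-forward measures $(f_n)_*\mu_n$ converge weakly to $\mu$. Theorem. Let a sequence $\{X_n\}$ of metric-measure spaces converge to a metric-measure space $X=(X,d,\mu)$ in the sense of Fukaya. Assume that $d$ is a length metric, that is, every two points of $X$ are joined by a geodesic segment whose length is the distance between them, and that there is $\Lambda>0$ such that $$\mu(B_{r_1}(x))\le\left(\frac{r_1}{r_2}\right)^{\Lambda}\mu(B_{r_2}(x))\qquad\text{for all } x\in X \text{ and } r_1\ge r_2>0.$$ Then $$\lambda_k(X,\rho)=\lim_{n\to\infty}\lambda_k(X_n,\rho)$$ for all $\rho>0$ and all $k\ge 1$ such that $\lambda_k(X,\rho)<\rho^{-2}$, the limit being taken in $[0,+\infty]$. -/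

import Mathlib

open MeasureTheory Filter Topology

noncomputable section

/-- Every pair of points of `X` is joined by a geodesic segment realizing the distance. -/
def IsLengthMetric (X : Type*) [MetricSpace X] : Prop :=
  ∀ x y : X, ∃ γ : ℝ → X, γ 0 = x ∧ γ (dist x y) = y ∧
    ∀ s ∈ Set.Icc 0 (dist x y), ∀ t ∈ Set.Icc 0 (dist x y), dist (γ s) (γ t) = |s - t|

/-- Bishop--Gromov type inequality: the ratio of the measures of concentric balls is at most
`(r₁ / r₂) ^ Λ`. The ratio is cleared of its denominator, so that no convention on division by
zero enters. -/
def BishopGromov {X : Type*} [MetricSpace X] [MeasurableSpace X] (μ : Measure X) (Λ : ℝ) : Prop :=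
  ∀ (x : X) (r₁ r₂ : ℝ), 0 < r₂ → r₂ ≤ r₁ →
    μ.real (Metric.ball x r₁) ≤ (r₁ / r₂) ^ Λ * μ.real (Metric.ball x r₂)

/-- Convergence of the metric-measure spaces `(Xs n, μs n)` to `(X, μ)` in the sense of Fukaya. -/
def FukayaConverges {Xs : ℕ → Type*} [∀ n, MetricSpace (Xs n)] [∀ n, MeasurableSpace (Xs n)]
    (μs : ∀ n, Measure (Xs n)) [∀ n, IsFiniteMeasure (μs n)]
    {X : Type*} [MetricSpace X] [MeasurableSpace X] [BorelSpace X]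
    (μ : Measure X) [IsFiniteMeasure μ] : Prop :=
  ∃ (σ : ℕ → ℝ) (f : ∀ n, Xs n → X),
    (∀ n, 0 < σ n) ∧ Tendsto σ atTop (𝓝 0) ∧
    (∀ n, Measurable (f n)) ∧
    (∀ n, ∀ x : X, ∃ z : Xs n, dist x (f n z) ≤ σ n) ∧
    (∀ n, ∀ z w : Xs n, |dist (f n z) (f n w) - dist z w| < σ n) ∧
    Tendsto (fun n => FiniteMeasure.map (⟨μs n, inferInstance⟩ : FiniteMeasure (Xs n)) (f n)) atTop
      (𝓝 (⟨μ, inferInstance⟩ : FiniteMeasure X))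

section Operator

variable {X : Type*} [MetricSpace X] [MeasurableSpace X]

/-- The formula for the `ρ`-Laplacian of a function `u`. -/
def rhoLaplacianFun (μ : Measure X) (ρ : ℝ) (u : X → ℝ) (x : X) : ℝ :=
  1 / (ρ ^ 2 * μ.real (Metric.ball x ρ)) * ∫ y in Metric.ball x ρ, (u x - u y) ∂μ

theorem rhoLaplacianFun_congr (μ : Measure X) (ρ : ℝ) {u v : X → ℝ} (h : u =ᵐ[μ] v) :
    rhoLaplacianFun μ ρ u =ᵐ[μ] rhoLaplacianFun μ ρ v := by
  filter_upwards [h] with x hx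
  unfold rhoLaplacianFun
  congr 1
  refine integral_congr_ae ?_
  filter_upwards [ae_restrict_of_ae h] with y hy
  rw [hx, hy]

variable [CompactSpace X] [BorelSpace X]

theorem exists_ball_lower_bound (μ : Measure X) [IsFiniteMeasure μ] {ρ : ℝ} (hρ : 0 < ρ) :
    ∃ c : ℝ, 0 < c ∧ ∀ᵐ x ∂μ, c ≤ μ.real (Metric.ball x ρ) := by
  obtain ⟨t, -, ht⟩ := (isCompact_univ (X := X)).elim_nhds_subcover
    (fun x => Metric.ball x (ρ / 2)) (fun x _ => Metric.ball_mem_nhds x (by positivity))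
  have key : ∀ s : Finset X, ∃ c : ℝ, 0 < c ∧ ∀ z ∈ s,
      ∀ᵐ x ∂μ, x ∈ Metric.ball z (ρ / 2) → c ≤ μ.real (Metric.ball x ρ) := by
    classical
    intro s
    induction s using Finset.induction_on with
    | empty => exact ⟨1, one_pos, by simp⟩
    | insert a s _ ih =>
      obtain ⟨c, hc, h⟩ := ih
      by_cases h0 : μ (Metric.ball a (ρ / 2)) = 0
      · refine ⟨c, hc, fun z hz => ?_⟩
        rcases Finset.mem_insert.1 hz with rfl | hz
        · filter_upwards [measure_eq_zero_iff_ae_notMem.1 h0] with x hx hx'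
          exact absurd hx' hx
        · exact h z hz
      · have hpos : 0 < μ.real (Metric.ball a (ρ / 2)) :=
          ENNReal.toReal_pos h0 (measure_ne_top _ _)
        refine ⟨min c (μ.real (Metric.ball a (ρ / 2))), lt_min hc hpos, fun z hz => ?_⟩
        rcases Finset.mem_insert.1 hz with rfl | hz
        · refine Eventually.of_forall fun x hx => (min_le_right _ _).trans ?_
          refine measureReal_mono (fun y hy => ?_)
          simp only [Metric.mem_ball] at hx hy ⊢
          have := dist_triangle_right y x z
          linarith
        · filter_upwards [h z hz] with x hx hx'
          exact (min_le_left _ _).trans (hx hx')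
  obtain ⟨c, hc, h⟩ := key t
  refine ⟨c, hc, ?_⟩
  filter_upwards [(Filter.eventually_all_finset t).2 h] with x hx
  obtain ⟨z, hz, hxz⟩ := Set.mem_iUnion₂.1 (ht (Set.mem_univ x))
  exact hx z hz hxz

theorem memLp_rhoLaplacianFun_aux (μ : Measure X) [IsFiniteMeasure μ] (ρ : ℝ) :
    ∃ C : ℝ, 0 ≤ C ∧ ∀ u : Lp ℝ 2 μ,
      AEStronglyMeasurable (rhoLaplacianFun μ ρ u) μ ∧
      ∀ᵐ x ∂μ, ‖rhoLaplacianFun μ ρ u x‖ ≤ C * (‖u x‖ + ∫ y, ‖u y‖ ∂μ) := by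
  have hmeas : ∀ u : Lp ℝ 2 μ, AEStronglyMeasurable (rhoLaplacianFun μ ρ u) μ := by
    intro u
    have hu : StronglyMeasurable (u : X → ℝ) := Lp.stronglyMeasurable u
    have hS : MeasurableSet {p : X × X | dist p.2 p.1 < ρ} :=
      (isOpen_lt (by fun_prop) continuous_const).measurableSet
    have h1 : Measurable fun x => μ.real (Metric.ball x ρ) :=
      (measurable_measure_prodMk_left (ν := μ) hS).ennreal_toReal
    have h2 : StronglyMeasurable fun x => ∫ y in Metric.ball x ρ, (u x - u y) ∂μ := by
      have h3 : StronglyMeasurable (fun p : X × X =>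
          Set.indicator {p : X × X | dist p.2 p.1 < ρ} (fun p => u p.1 - u p.2) p) :=
        ((hu.comp_measurable measurable_fst).sub
          (hu.comp_measurable measurable_snd)).indicator hS
      have h4 := h3.integral_prod_right' (ν := μ)
      convert h4 using 2 with x
      rw [← integral_indicator Metric.isOpen_ball.measurableSet]
      rfl
    exact ((measurable_const.div (measurable_const.mul h1)).stronglyMeasurable.mul
      h2).aestronglyMeasurable
  rcases le_or_gt ρ 0 with hρ | hρ
  · exact ⟨0, le_rfl, fun u => ⟨hmeas u, Eventually.of_forall fun x => by
      simp [rhoLaplacianFun, Metric.ball_eq_empty.2 hρ]⟩⟩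
  obtain ⟨c, hc, h⟩ := exists_ball_lower_bound μ hρ
  refine ⟨(ρ ^ 2)⁻¹ * max 1 c⁻¹, by positivity, fun u => ⟨hmeas u, ?_⟩⟩
  have hint : Integrable (u : X → ℝ) μ := (Lp.memLp u).integrable (by norm_num)
  filter_upwards [h] with x hx
  have hm : 0 < μ.real (Metric.ball x ρ) := hc.trans_le hx
  have e : rhoLaplacianFun μ ρ u x = (ρ ^ 2)⁻¹ *
      (u x - (μ.real (Metric.ball x ρ))⁻¹ * ∫ y in Metric.ball x ρ, u y ∂μ) := by
    unfold rhoLaplacianFun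
    rw [integral_sub (integrable_const _) hint.integrableOn]
    simp only [integral_const, measureReal_restrict_apply_univ, smul_eq_mul]
    field_simp
  have hI : ‖∫ y in Metric.ball x ρ, u y ∂μ‖ ≤ ∫ y, ‖u y‖ ∂μ :=
    (norm_integral_le_integral_norm _).trans
      (setIntegral_le_integral hint.norm (Eventually.of_forall fun _ => norm_nonneg _))
  have hI0 : 0 ≤ ∫ y, ‖u y‖ ∂μ := integral_nonneg fun _ => norm_nonneg _
  rw [e, norm_mul, mul_assoc, Real.norm_of_nonneg (by positivity : 0 ≤ (ρ ^ 2)⁻¹)]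
  refine mul_le_mul_of_nonneg_left ?_ (by positivity)
  calc _ ≤ ‖u x‖ + (μ.real (Metric.ball x ρ))⁻¹ * ‖∫ y in Metric.ball x ρ, u y ∂μ‖ := by
        refine (norm_sub_le _ _).trans_eq ?_
        rw [norm_mul, Real.norm_of_nonneg (inv_nonneg.2 hm.le)]
    _ ≤ 1 * ‖u x‖ + c⁻¹ * ∫ y, ‖u y‖ ∂μ := by
        rw [one_mul]
        gcongr
    _ ≤ max 1 c⁻¹ * ‖u x‖ + max 1 c⁻¹ * ∫ y, ‖u y‖ ∂μ := by
        gcongr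
        · exact le_max_left _ _
        · exact le_max_right _ _
    _ = _ := by ring

theorem memLp_rhoLaplacianFun (μ : Measure X) [IsFiniteMeasure μ] (ρ : ℝ) (u : Lp ℝ 2 μ) :
    MemLp (rhoLaplacianFun μ ρ u) 2 μ := by
  obtain ⟨C, -, h⟩ := memLp_rhoLaplacianFun_aux μ ρ
  refine MemLp.mono' (g := fun x => C * (‖u x‖ + ∫ y, ‖u y‖ ∂μ)) ?_ (h u).1 (h u).2
  exact (((Lp.memLp u).norm).add (memLp_const _)).const_mul C

/-- The `ρ`-Laplacian as a linear map on `L²(X, μ)`. -/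
def rhoLaplacianLin (μ : Measure X) [IsFiniteMeasure μ] (ρ : ℝ) : Lp ℝ 2 μ →ₗ[ℝ] Lp ℝ 2 μ where
  toFun u := (memLp_rhoLaplacianFun μ ρ u).toLp _
  map_add' u v := by
    rw [← MemLp.toLp_add]
    refine MemLp.toLp_congr _ _ ?_
    refine (rhoLaplacianFun_congr μ ρ (Lp.coeFn_add u v)).trans (Eventually.of_forall fun x => ?_)
    have hi : ∀ w : Lp ℝ 2 μ, Integrable (fun y => w x - w y) (μ.restrict (Metric.ball x ρ)) :=
      fun w => (integrable_const _).sub ((Lp.memLp w).integrable (by norm_num)).integrableOn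
    simp only [rhoLaplacianFun, Pi.add_apply]
    rw [← mul_add, ← integral_add (hi u) (hi v)]
    congr 2
    ext y
    ring
  map_smul' a u := by
    rw [RingHom.id_apply, ← MemLp.toLp_const_smul]
    refine MemLp.toLp_congr _ _ ?_
    refine (rhoLaplacianFun_congr μ ρ (Lp.coeFn_smul a u)).trans (Eventually.of_forall fun x => ?_)
    simp only [rhoLaplacianFun, Pi.smul_apply, smul_eq_mul, ← mul_sub]
    rw [integral_const_mul]
    ring

theorem exists_rhoLaplacian_bound (μ : Measure X) [IsFiniteMeasure μ] (ρ : ℝ) :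
    ∃ K : ℝ, ∀ u : Lp ℝ 2 μ, ‖rhoLaplacianLin μ ρ u‖ ≤ K * ‖u‖ := by
  obtain ⟨C, hC, h⟩ := memLp_rhoLaplacianFun_aux μ ρ
  refine ⟨C * (1 + ‖indicatorConstLp 2 MeasurableSet.univ (measure_ne_top μ _) (1 : ℝ)‖ ^ 2), ?_⟩
  intro u
  set e := indicatorConstLp 2 MeasurableSet.univ (measure_ne_top μ _) (1 : ℝ) with he
  have hu1 : ∫ y, ‖u y‖ ∂μ ≤ ‖e‖ * ‖u‖ := by
    have h1 : inner ℝ e |u| = ∫ y, ‖u y‖ ∂μ := by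
      rw [L2.inner_indicatorConstLp_one, Measure.restrict_univ]
      refine integral_congr_ae ?_
      filter_upwards [Lp.coeFn_abs u] with y hy
      rw [hy, Real.norm_eq_abs]
    rw [← h1]
    exact (real_inner_le_norm _ _).trans_eq (by rw [norm_abs_eq_norm])
  have key : ‖rhoLaplacianLin μ ρ u‖ ≤ ‖C • (|u| + (∫ y, ‖u y‖ ∂μ) • e)‖ := by
    refine Lp.norm_le_norm_of_ae_le ?_
    have e1 : indicatorConstLp 2 MeasurableSet.univ (measure_ne_top μ _) (1 : ℝ) =ᵐ[μ] _ :=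
      indicatorConstLp_coeFn
    filter_upwards [(h u).2, (memLp_rhoLaplacianFun μ ρ u).coeFn_toLp, Lp.coeFn_abs u,
      Lp.coeFn_smul C (|u| + (∫ y, ‖u y‖ ∂μ) • e), Lp.coeFn_add |u| ((∫ y, ‖u y‖ ∂μ) • e),
      Lp.coeFn_smul (∫ y, ‖u y‖ ∂μ) e, e1] with x a1 a2 a3 a4 a5 a6 a7
    have a8 : rhoLaplacianLin μ ρ u x = rhoLaplacianFun μ ρ u x := a2
    rw [a8, a4, Pi.smul_apply, a5, Pi.add_apply, a6, Pi.smul_apply, a3, he, a7]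
    refine a1.trans ((le_abs_self _).trans_eq ?_)
    simp [Real.norm_eq_abs]
  refine key.trans ?_
  rw [norm_smul, Real.norm_of_nonneg hC, mul_assoc]
  refine mul_le_mul_of_nonneg_left ?_ hC
  refine (norm_add_le _ _).trans ?_
  rw [norm_abs_eq_norm, norm_smul, Real.norm_of_nonneg (integral_nonneg fun _ => norm_nonneg _)]
  nlinarith [norm_nonneg e, mul_le_mul_of_nonneg_right hu1 (norm_nonneg e)]

/-- The `ρ`-Laplacian `Δ^ρ` as a bounded operator on `L²(X, μ)`. -/
def rhoLaplacian (μ : Measure X) [IsFiniteMeasure μ] (ρ : ℝ) : Lp ℝ 2 μ →L[ℝ] Lp ℝ 2 μ :=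
  (rhoLaplacianLin μ ρ).mkContinuousOfExistsBound (exists_rhoLaplacian_bound μ ρ)

theorem rhoLaplacian_ae (μ : Measure X) [IsFiniteMeasure μ] (ρ : ℝ) (u : Lp ℝ 2 μ) :
    ∀ᵐ x ∂μ, rhoLaplacian μ ρ u x =
      1 / (ρ ^ 2 * μ.real (Metric.ball x ρ)) * ∫ y in Metric.ball x ρ, (u x - u y) ∂μ :=
  (memLp_rhoLaplacianFun μ ρ u).coeFn_toLp

end Operator

section Spectrum

variable {E : Type*} [NormedAddCommGroup E] [NormedSpace ℝ E]

/-- The multiplicity of `t` as an eigenvalue of `T`: the dimension of `ker (T - t)`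
(`0` if that dimension is infinite). -/
def eigenMult (T : E →L[ℝ] E) (t : ℝ) : ℕ :=
  Module.finrank ℝ (Module.End.eigenspace (T : E →ₗ[ℝ] E) t)

/-- The discrete spectrum: isolated points of the spectrum that are eigenvalues of finite
multiplicity. -/
def discreteSpectrum (T : E →L[ℝ] E) : Set ℝ :=
  {t | t ∈ spectrum ℝ T ∧ (∃ ε > 0, ∀ s ∈ spectrum ℝ T, |s - t| < ε → s = t) ∧
    Module.End.HasEigenvalue (T : E →ₗ[ℝ] E) t ∧
    FiniteDimensional ℝ (Module.End.eigenspace (T : E →ₗ[ℝ] E) t)}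

/-- The essential spectrum: the complement of the discrete spectrum in the spectrum. -/
def essentialSpectrum (T : E →L[ℝ] E) : Set ℝ :=
  spectrum ℝ T \ discreteSpectrum T

/-- `λ_∞`: the infimum of the essential spectrum, equal to `⊤` if the latter is empty. -/
def lambdaInfty (T : E →L[ℝ] E) : EReal :=
  sInf ((fun t : ℝ => (t : EReal)) '' essentialSpectrum T)

/-- `λ_k`, for `k ≥ 1`: the `k`-th smallest, with multiplicities, of the eigenvalues of `T` smaller
than `λ_∞`, and `λ_∞` if there are fewer than `k` of them. Thus it is the smallest `t` such that
the multiplicities of the eigenvalues that are `≤ t` and `< λ_∞` add up to at least `k`. -/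
def lambdaK (T : E →L[ℝ] E) (k : ℕ) : EReal :=
  sInf (insert (lambdaInfty T) {l : EReal | ∃ t : ℝ, l = t ∧ ∃ F : Finset ℝ,
    (∀ s ∈ F, Module.End.HasEigenvalue (T : E →ₗ[ℝ] E) s ∧ s ≤ t ∧ (s : EReal) < lambdaInfty T) ∧
    k ≤ ∑ s ∈ F, eigenMult T s})

end Spectrum

/-- `λ_k(X, ρ)`: the `k`-th eigenvalue of the `ρ`-Laplacian of `(X, μ)`. -/
def mmLambda {X : Type*} [MetricSpace X] [MeasurableSpace X] [CompactSpace X] [BorelSpace X]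
    (μ : Measure X) [IsFiniteMeasure μ] (ρ : ℝ) (k : ℕ) : EReal :=
  lambdaK (rhoLaplacian μ ρ) k

end

set_option linter.unusedSectionVars false

/-! Write V(x) = μ(B_ρ(x)) and let A be the averaging over ρ-balls, so that Δ^ρ = ρ⁻²(1 - A). In
L²(Vμ) the operator A is compact and symmetric, with quadratic form Q(u) = ∬_{d(x,y)<ρ} u(x)u(y)
(`exists_conj_rhoLaplacian`). Hence the spectrum of Δ^ρ away from ρ⁻² is discrete and, by min-max,
λ_k < t ≤ ρ⁻² amounts, up to an arbitrarily small loss in t, to a k-dimensional space on which Q(u)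
≥ (1 - ρ²t) ∫ V u² (`HasFormSubspace`). It remains to carry such spaces between X and X_n, in both
directions, with small loss.

A fine partition of unity on X pulls back along f_n to X_n. If ψ and ψ' are the two partitions, the
map u ↦ ∑ (∫ψ_i u / ∫ψ'_i) ψ'_i preserves the cell integrals of u. It therefore almost preserves Q
if the kernel 1_{d<ρ} is almost constant on products of cells, and by Cauchy–Schwarz and Jensen it
hardly increases ∫ V u² (`BallApprox.transport_estimates`). Positivity of the form makes it
injective on the given space.

The kernel jumps across d = ρ, but the pairs concerned lie in thin annuli, whose measure
Bishop–Gromov makes uniformly small (`BishopGromov.exists_integral_bumpProfile_le`); Schur's test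
turns this into a bound on Q. Weak convergence enters only through the finitely many integrals of
the partition functions, since integrals of equi-Lipschitz functions are uniformly close to Riemann
sums (`abs_integral_comp_sub_integral_le`). The outcome is
`FukayaConverges.eventually_hasFormSubspace`. -/

noncomputable section

/-! ### Eigenspaces and quadratic form of a compact symmetric operator. -/

section CompactSymmetric

open Module End

variable {H : Type*} [NormedAddCommGroup H] [InnerProductSpace ℝ H]

theorem exists_submodule_le_finrank_eq {E : Type*} [AddCommGroup E] [Module ℝ E]
    {S : Submodule ℝ E} {k : ℕ} (hk : k ≤ finrank ℝ S) : ∃ W ≤ S, finrank ℝ W = k := by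
  obtain ⟨f, hf⟩ := exists_linearIndependent_of_le_finrank hk
  refine ⟨Submodule.span ℝ (Set.range fun i => (f i : E)), ?_, ?_⟩
  · rw [Submodule.span_le]
    rintro _ ⟨i, rfl⟩
    exact (f i).2
  · have := finrank_span_eq_card (hf.map' S.subtype (Submodule.ker_subtype S))
    rwa [Fintype.card_fin] at this

/-- Distinct eigenspaces are orthogonal, so the components `v s` diagonalize the norm and the form
simultaneously. -/
theorem exists_eigenvector_sum {B : H →L[ℝ] H} (hsymm : (B : H →ₗ[ℝ] H).IsSymmetric)
    (F : Finset ℝ) {u : H} (hu : u ∈ ⨆ s ∈ F, eigenspace (B : H →ₗ[ℝ] H) s) :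
    ∃ v : ℝ → H, ‖u‖ ^ 2 = ∑ s ∈ F, ‖v s‖ ^ 2 ∧ inner ℝ (B u) u = ∑ s ∈ F, s * ‖v s‖ ^ 2 := by
  obtain ⟨v, rfl⟩ := (Submodule.mem_iSup_finset_iff_exists_sum _ _).1 hu
  refine ⟨fun s => v s, ?_, ?_⟩
  · exact hsymm.orthogonalFamily_eigenspaces.norm_sum v F
  · have hB : B (∑ s ∈ F, (v s : H)) = ∑ s ∈ F, ((s • v s : eigenspace (B : H →ₗ[ℝ] H) s) : H) := by
      rw [map_sum]
      exact Finset.sum_congr rfl fun s _ => mem_eigenspace_iff.1 (v s).2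
    rw [hB]
    refine (hsymm.orthogonalFamily_eigenspaces.inner_sum (fun s => s • v s) v F).trans ?_
    refine Finset.sum_congr rfl fun s _ => ?_
    rw [inner_smul_left, real_inner_self_eq_norm_sq]
    simp

theorem finrank_biSup_eigenspace {B : H →L[ℝ] H} (F : Finset ℝ)
    (hfin : ∀ s ∈ F, FiniteDimensional ℝ (eigenspace (B : H →ₗ[ℝ] H) s)) :
    FiniteDimensional ℝ (⨆ s ∈ F, eigenspace (B : H →ₗ[ℝ] H) s : Submodule ℝ H) ∧
    finrank ℝ (⨆ s ∈ F, eigenspace (B : H →ₗ[ℝ] H) s : Submodule ℝ H) =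
      ∑ s ∈ F, finrank ℝ (eigenspace (B : H →ₗ[ℝ] H) s) := by
  classical
  induction F using Finset.induction_on with
  | empty =>
    have : (⨆ s ∈ (∅ : Finset ℝ), eigenspace (B : H →ₗ[ℝ] H) s : Submodule ℝ H) = ⊥ := by simp
    rw [this]
    exact ⟨inferInstance, by simp⟩
  | insert a F ha ih =>
    obtain ⟨h1, h2⟩ := ih fun s hs => hfin s (Finset.mem_insert_of_mem hs)
    have h3 := hfin a (Finset.mem_insert_self _ _)
    have hd : Disjoint (eigenspace (B : H →ₗ[ℝ] H) a) (⨆ s ∈ F, eigenspace (B : H →ₗ[ℝ] H) s) :=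
      (iSupIndep_def.1 (eigenspaces_iSupIndep (B : H →ₗ[ℝ] H)) a).mono_right
        (iSup₂_le fun s hs => le_iSup₂_of_le s (by rintro rfl; exact ha hs) le_rfl)
    rw [Finset.iSup_insert, Finset.sum_insert ha, ← h2]
    refine ⟨inferInstance, ?_⟩
    rw [← Submodule.finrank_sup_add_finrank_inf_eq, hd.eq_bot, finrank_bot, add_zero]

/-- Unit eigenvectors of distinct eigenvalues are orthonormal, so by Pythagoras their images stay at
distance at least `ε` from each other, and no subsequence of the images converges. -/
theorem IsCompactOperator.finite_setOf_le_abs_eigenvalue {B : H →L[ℝ] H}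
    (hB : IsCompactOperator B) (hsymm : (B : H →ₗ[ℝ] H).IsSymmetric) {ε : ℝ} (hε : 0 < ε) :
    {s : ℝ | HasEigenvalue (B : H →ₗ[ℝ] H) s ∧ ε ≤ |s|}.Finite := by
  by_contra hinf
  let a := (Set.Infinite.natEmbedding _ hinf)
  have ha : ∀ n, ∃ e : H, ‖e‖ = 1 ∧ B e = (a n : ℝ) • e := by
    intro n
    obtain ⟨e, he⟩ := (a n).2.1.exists_hasEigenvector
    have he0 : ‖e‖ ≠ 0 := norm_ne_zero_iff.2 he.2
    refine ⟨‖e‖⁻¹ • e, by rw [norm_smul, norm_inv, norm_norm, inv_mul_cancel₀ he0], ?_⟩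
    have : B e = (a n : ℝ) • e := he.apply_eq_smul
    rw [map_smul, this, smul_comm]
  choose e he1 heB using ha
  have horth : ∀ m n, m ≠ n → inner ℝ (e m) (e n) = 0 := by
    intro m n hmn
    have hne : (a m : ℝ) ≠ a n := fun h => hmn (a.injective (Subtype.ext h))
    exact hsymm.orthogonalFamily_eigenspaces hne
      (⟨e m, mem_eigenspace_iff.2 (heB m)⟩ : eigenspace (B : H →ₗ[ℝ] H) (a m))
      (⟨e n, mem_eigenspace_iff.2 (heB n)⟩ : eigenspace (B : H →ₗ[ℝ] H) (a n))
  obtain ⟨K, hK, hK'⟩ := hB.image_closedBall_subset_compact 1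
  obtain ⟨y, -, ψ, hψ, hy⟩ := hK.tendsto_subseq (x := fun n => B (e n))
    (fun n => hK' ⟨e n, by simp [he1], rfl⟩)
  obtain ⟨N, hN⟩ := Metric.cauchySeq_iff'.1 hy.cauchySeq ε hε
  have h1 := hN (N + 1) (Nat.le_succ N)
  have hne : ψ (N + 1) ≠ ψ N := fun h => by simpa using hψ.injective h
  simp only [Function.comp_apply, dist_eq_norm, heB] at h1
  have h2 : ‖(a (ψ (N+1)) : ℝ) • e (ψ (N+1)) - (a (ψ N) : ℝ) • e (ψ N)‖ ^ 2
      = (a (ψ (N+1)) : ℝ) ^ 2 + (a (ψ N) : ℝ) ^ 2 := by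
    rw [norm_sub_sq_real, inner_smul_left, inner_smul_right, horth _ _ hne, norm_smul, norm_smul,
      he1, he1]
    simp
  have h3 : ε ^ 2 ≤ (a (ψ (N+1)) : ℝ) ^ 2 := by
    rw [← sq_abs (a (ψ (N+1)) : ℝ)]
    exact pow_le_pow_left₀ hε.le (a (ψ (N+1))).2.2 2
  nlinarith [norm_nonneg ((a (ψ (N+1)) : ℝ) • e (ψ (N+1)) - (a (ψ N) : ℝ) • e (ψ N)),
    sq_nonneg (a (ψ N) : ℝ)]

variable [CompleteSpace H]

/-- On the orthogonal complement of the eigenspaces of eigenvalues `≥ β`, the quadratic form of a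
compact symmetric operator is at most `β`. -/
theorem IsCompactOperator.inner_le_of_mem_orthogonal {B : H →L[ℝ] H}
    (hB : IsCompactOperator B) (hsymm : (B : H →ₗ[ℝ] H).IsSymmetric) {β : ℝ} {u : H}
    (hu : ∀ s, β ≤ s → ∀ v ∈ eigenspace (B : H →ₗ[ℝ] H) s, inner ℝ v u = 0) :
    inner ℝ (B u) u ≤ β * ‖u‖ ^ 2 := by
  let U : Submodule ℝ H := ⨆ s : Set.Iio β, eigenspace (B : H →ₗ[ℝ] H) s
  have hUle : ∀ s, s < β → eigenspace (B : H →ₗ[ℝ] H) s ≤ U := fun s hs =>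
    le_iSup (fun s : Set.Iio β => eigenspace (B : H →ₗ[ℝ] H) s) ⟨s, hs⟩
  have hform : ∀ w ∈ U, inner ℝ (B w) w ≤ β * ‖w‖ ^ 2 := by
    intro w hw
    classical
    obtain ⟨F, hF⟩ := Submodule.mem_iSup_iff_exists_finset.1 hw
    have hF' : w ∈ ⨆ s ∈ F.image ((↑) : Set.Iio β → ℝ), eigenspace (B : H →ₗ[ℝ] H) s := by
      rwa [Finset.iSup_finset_image]
    obtain ⟨v, h1, h2⟩ := exists_eigenvector_sum hsymm _ hF'
    rw [h1, h2, Finset.mul_sum]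
    refine Finset.sum_le_sum fun s hs => ?_
    obtain ⟨t, -, rfl⟩ := Finset.mem_image.1 hs
    exact mul_le_mul_of_nonneg_right (Set.mem_Iio.1 t.2).le (sq_nonneg _)
  have hclos : ∀ w ∈ U.topologicalClosure, inner ℝ (B w) w ≤ β * ‖w‖ ^ 2 := by
    intro w hw
    have hcl : IsClosed {w : H | inner ℝ (B w) w ≤ β * ‖w‖ ^ 2} :=
      isClosed_le (by fun_prop) (by fun_prop)
    exact closure_minimal (s := (U : Set H)) hform hcl hw
  apply hclos
  have hort : ∀ v ∈ U, ∀ s, β ≤ s → ∀ w ∈ eigenspace (B : H →ₗ[ℝ] H) s, inner ℝ w v = 0 := by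
    intro v hv s hs w hw
    have : U ≤ (Submodule.span ℝ {w})ᗮ := by
      refine iSup_le fun t z hz => ?_
      rw [Submodule.mem_orthogonal_singleton_iff_inner_right]
      have hne : s ≠ t := (lt_of_lt_of_le t.2 hs).ne'
      exact hsymm.orthogonalFamily_eigenspaces hne (⟨w, hw⟩ : eigenspace (B : H →ₗ[ℝ] H) s)
        (⟨z, hz⟩ : eigenspace (B : H →ₗ[ℝ] H) t)
    exact (Submodule.mem_orthogonal_singleton_iff_inner_right).1 (this hv)
  have hort' : ∀ v ∈ U.topologicalClosure, ∀ s, β ≤ s → ∀ w ∈ eigenspace (B : H →ₗ[ℝ] H) s,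
      inner ℝ w v = 0 := by
    intro v hv s hs w hw
    have hcl : IsClosed {v : H | inner ℝ w v = 0} :=
      isClosed_eq (by fun_prop) (by fun_prop)
    exact closure_minimal (s := (U : Set H)) (fun v hv => hort v hv s hs w hw) hcl hv
  have : CompleteSpace U.topologicalClosure :=
    U.isClosed_topologicalClosure.completeSpace_coe
  let P := U.topologicalClosure.starProjection
  have hPu : P u ∈ U.topologicalClosure := Submodule.starProjection_apply_mem _ _
  -- The residue is orthogonal to the eigenspaces below `β` by projection, and to the others because
  -- both `u` and the closure of `U` are. Eigenvectors being total, `u = P u`.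
  have hres : u - P u ∈ (⨆ s, eigenspace (B : H →ₗ[ℝ] H) s)ᗮ := by
    rw [Submodule.mem_orthogonal]
    intro z hz
    have : (⨆ s, eigenspace (B : H →ₗ[ℝ] H) s) ≤ (Submodule.span ℝ {u - P u})ᗮ := by
      refine iSup_le fun s v hv => ?_
      rw [Submodule.mem_orthogonal_singleton_iff_inner_left]
      rcases lt_or_ge s β with h | h
      · exact (Submodule.mem_orthogonal _ _).1 (Submodule.sub_starProjection_mem_orthogonal u) v
          (U.le_topologicalClosure (hUle s h hv))
      · rw [inner_sub_right, hu s h v hv, hort' _ hPu s h v hv, sub_zero]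
    exact (Submodule.mem_orthogonal_singleton_iff_inner_left).1 (this hz)
  rw [ContinuousLinearMap.orthogonalComplement_iSup_eigenspaces_eq_bot hB hsymm,
    Submodule.mem_bot, sub_eq_zero] at hres
  rw [hres]
  exact hPu

end CompactSymmetric

/-! ### Min-max for an operator conjugate to `c (1 - B)` with `B` compact symmetric. -/

section Conjugate

open Module End

variable {H : Type*} [NormedAddCommGroup H] [InnerProductSpace ℝ H]
  {B T : H →L[ℝ] H} {M : H ≃L[ℝ] H} {c : ℝ}

theorem mem_eigenspace_iff_of_conj (hc : c ≠ 0) (hT : ∀ u, M (T u) = c • (M u - B (M u)))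
    {s : ℝ} {u : H} : u ∈ eigenspace (T : H →ₗ[ℝ] H) s ↔
      M u ∈ eigenspace (B : H →ₗ[ℝ] H) (1 - s / c) := by
  rw [mem_eigenspace_iff, mem_eigenspace_iff]
  change T u = s • u ↔ B (M u) = _
  rw [← M.injective.eq_iff, hT, map_smul, sub_smul, one_smul, div_eq_inv_mul, mul_smul,
    ← smul_right_injective H hc |>.eq_iff (a := B (M u)), smul_sub, smul_sub, smul_inv_smul₀ hc]
  constructor <;> intro h
  · rw [← h]; abel
  · rw [h]; abel

theorem map_eigenspace_of_conj (hc : c ≠ 0) (hT : ∀ u, M (T u) = c • (M u - B (M u))) (s : ℝ) :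
    (eigenspace (T : H →ₗ[ℝ] H) s).map (M.toLinearEquiv : H →ₗ[ℝ] H) =
      eigenspace (B : H →ₗ[ℝ] H) (1 - s / c) := by
  ext v
  rw [Submodule.mem_map]
  constructor
  · rintro ⟨u, hu, rfl⟩
    exact (mem_eigenspace_iff_of_conj hc hT).1 hu
  · intro hv
    refine ⟨M.symm v, (mem_eigenspace_iff_of_conj hc hT).2 ?_, M.apply_symm_apply v⟩
    rwa [M.apply_symm_apply]

theorem hasEigenvalue_iff_of_conj (hc : c ≠ 0) (hT : ∀ u, M (T u) = c • (M u - B (M u))) {s : ℝ} :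
    HasEigenvalue (T : H →ₗ[ℝ] H) s ↔ HasEigenvalue (B : H →ₗ[ℝ] H) (1 - s / c) := by
  rw [hasEigenvalue_iff, hasEigenvalue_iff, ← map_eigenspace_of_conj hc hT, Ne, Ne,
    Submodule.map_eq_bot_iff]

theorem eigenMult_eq_of_conj (hc : c ≠ 0) (hT : ∀ u, M (T u) = c • (M u - B (M u))) (s : ℝ) :
    eigenMult T s = finrank ℝ (eigenspace (B : H →ₗ[ℝ] H) (1 - s / c)) := by
  rw [← map_eigenspace_of_conj hc hT]
  exact (LinearEquiv.finrank_map_eq M.toLinearEquiv _).symm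

variable [CompleteSpace H]

/-- Fredholm alternative: `s ≠ c` corresponds to the nonzero number `1 - s / c`, and `s - T` is `-c
((1 - s / c) - B)` conjugated by `M`. -/
theorem hasEigenvalue_of_mem_spectrum_of_conj (hc : c ≠ 0)
    (hT : ∀ u, M (T u) = c • (M u - B (M u))) (hB : IsCompactOperator B) {s : ℝ} (hsc : s ≠ c)
    (hs : s ∈ spectrum ℝ T) : HasEigenvalue (B : H →ₗ[ℝ] H) (1 - s / c) := by
  have h0 : 1 - s / c ≠ 0 := by
    rw [sub_ne_zero, Ne, eq_comm, div_eq_one_iff_eq hc]; exact hsc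
  rw [hB.hasEigenvalue_iff_mem_spectrum h0]
  intro h
  apply hs
  rw [spectrum.mem_resolventSet_iff, ContinuousLinearMap.isUnit_iff_bijective] at h ⊢
  have e : ((algebraMap ℝ (H →L[ℝ] H) s - T : H →L[ℝ] H) : H → H) =
      M.symm ∘ (fun v => (-c) • v) ∘
        (algebraMap ℝ (H →L[ℝ] H) (1 - s / c) - B : H →L[ℝ] H) ∘ M := by
    funext u
    apply M.injective
    simp only [Function.comp_apply, M.apply_symm_apply]
    rw [Algebra.algebraMap_eq_smul_one, Algebra.algebraMap_eq_smul_one]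
    change M (s • u - T u) = (-c) • ((1 - s / c) • M u - B (M u))
    rw [map_sub, map_smul, hT]
    have : s • M u = c • (s / c) • M u := by rw [smul_smul, mul_div_cancel₀ _ hc]
    rw [this]
    module
  rw [e]
  refine M.symm.bijective.comp (Function.Bijective.comp ?_ (h.comp M.bijective))
  exact (LinearEquiv.smulOfNeZero ℝ H (-c) (neg_ne_zero.2 hc)).bijective

/-- The spectrum of `B` can accumulate only at `0`, which corresponds to `c`. So `c` is the only
candidate for the essential spectrum of `T`. -/
theorem le_lambdaInfty_of_conj (hc : 0 < c) (hT : ∀ u, M (T u) = c • (M u - B (M u)))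
    (hB : IsCompactOperator B) (hsymm : (B : H →ₗ[ℝ] H).IsSymmetric) :
    (c : EReal) ≤ lambdaInfty T := by
  refine le_sInf ?_
  rintro _ ⟨t, ht, rfl⟩
  by_contra hlt
  have htc : t ≠ c := by rintro rfl; exact hlt le_rfl
  have heig := fun {s} => hasEigenvalue_of_mem_spectrum_of_conj (s := s) hc.ne' hT hB
  have h0 : 1 - t / c ≠ 0 := by
    rw [sub_ne_zero, Ne, eq_comm, div_eq_one_iff_eq hc.ne']; exact htc
  refine ht.2 ⟨ht.1, ?_, (hasEigenvalue_iff_of_conj hc.ne' hT).2 (heig htc ht.1), ?_⟩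
  · have hpos : 0 < |t - c| / 2 := by have := abs_pos.2 (sub_ne_zero.2 htc); positivity
    -- Finitely many spectral points are this far from `c`; near `t` there are no others, so `t` is
    -- isolated.
    have hfin : {s : ℝ | s ∈ spectrum ℝ T ∧ |t - c| / 2 ≤ |s - c|}.Finite := by
      refine Set.Finite.subset (Set.Finite.preimage (f := fun s : ℝ => 1 - s / c)
        ?_ (hB.finite_setOf_le_abs_eigenvalue hsymm (div_pos hpos hc))) ?_
      · intro x _ y _ hxy
        simpa [hc.ne'] using hxy
      · rintro s ⟨h1, h2⟩
        have hsc : s ≠ c := by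
          rintro rfl; rw [sub_self, abs_zero] at h2; linarith
        refine ⟨heig hsc h1, ?_⟩
        have : (1 - s / c : ℝ) = -((s - c) / c) := by field_simp; ring
        change _ ≤ |1 - s / c|
        rw [this, abs_neg, abs_div, abs_of_pos hc]
        gcongr
    have hfin' := hfin.subset (Set.sdiff_subset (t := {t}))
    obtain ⟨ε, hε, hball⟩ := Metric.isOpen_iff.1 hfin'.isClosed.isOpen_compl t (by simp)
    refine ⟨min ε (|t - c| / 2), lt_min hε hpos, fun s hs hst => ?_⟩
    by_contra hne
    refine hball (a := s) (Metric.mem_ball.2 (hst.trans_le (min_le_left _ _))) ⟨⟨hs, ?_⟩, hne⟩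
    have h1 := hst.trans_le (min_le_right _ _)
    have h2 := abs_sub_le t s c
    rw [abs_sub_comm t s] at h2
    linarith
  · have h1 := ContinuousLinearMap.finite_dimensional_eigenspace hB _ h0
    rw [← map_eigenspace_of_conj hc.ne' hT] at h1
    exact Module.Finite.equiv (M.toLinearEquiv.submoduleMap _).symm

/-- First half of min-max: the eigenvalues counted by `lambdaK` become eigenvalues of `B` above `1 -
t / c`, and the sum of their eigenspaces has dimension at least `k`. -/
theorem exists_submodule_of_lambdaK_lt (hc : 0 < c) (hT : ∀ u, M (T u) = c • (M u - B (M u)))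
    (hB : IsCompactOperator B) (hsymm : (B : H →ₗ[ℝ] H).IsSymmetric) {k : ℕ}
    {t : ℝ} (htc : t ≤ c) (hk : lambdaK T k < t) :
    ∃ W : Submodule ℝ H, finrank ℝ W = k ∧
      ∀ u ∈ W, (1 - t / c) * ‖M u‖ ^ 2 ≤ inner ℝ (B (M u)) (M u) := by
  obtain ⟨l, hl, hlt⟩ := sInf_lt_iff.1 hk
  -- The value `lambdaInfty T` cannot be the one below `t`, since it is at least `c`.
  rcases hl with rfl | ⟨t', rfl, F, hF, hkF⟩
  · exact absurd (hlt.trans_le (EReal.coe_le_coe_iff.2 htc))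
      (not_lt.2 (le_lambdaInfty_of_conj hc hT hB hsymm))
  have htt : t' < t := EReal.coe_lt_coe_iff.1 hlt
  have hinj : Function.Injective fun s : ℝ => 1 - s / c := by
    intro x y hxy
    simpa [hc.ne'] using hxy
  let F' : Finset ℝ := F.map ⟨fun s => 1 - s / c, hinj⟩
  have hF' : ∀ s ∈ F', 1 - t / c ≤ s ∧ s ≠ 0 := by
    intro s hs
    obtain ⟨s, hs', rfl⟩ := Finset.mem_map.1 hs
    have h1 := (hF s hs').2.1
    have h2 : s / c < t / c := by gcongr; linarith
    have h3 : t / c ≤ 1 := by rwa [div_le_one hc]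
    exact ⟨by simp only [Function.Embedding.coeFn_mk]; linarith,
      by simp only [Function.Embedding.coeFn_mk]; linarith⟩
  obtain ⟨-, hd2⟩ := finrank_biSup_eigenspace (B := B) F' fun s hs =>
    ContinuousLinearMap.finite_dimensional_eigenspace hB s (hF' s hs).2
  have hle : k ≤ finrank ℝ (⨆ s ∈ F', eigenspace (B : H →ₗ[ℝ] H) s : Submodule ℝ H) := by
    rw [hd2, Finset.sum_map]
    refine hkF.trans_eq (Finset.sum_congr rfl fun s _ => ?_)
    exact eigenMult_eq_of_conj hc.ne' hT s
  obtain ⟨W, hW, hWk⟩ := exists_submodule_le_finrank_eq hle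
  refine ⟨W.comap (M.toLinearEquiv : H →ₗ[ℝ] H), ?_, fun u hu => ?_⟩
  · rw [← hWk, ← LinearEquiv.finrank_map_eq M.toLinearEquiv, Submodule.map_comap_eq_of_surjective]
    exact M.surjective
  · obtain ⟨v, h1, h2⟩ := exists_eigenvector_sum hsymm F' (hW hu)
    change ‖M u‖ ^ 2 = _ at h1
    change inner ℝ (B (M u)) (M u) = _ at h2
    rw [h1, h2, Finset.mul_sum]
    exact Finset.sum_le_sum fun s hs => mul_le_mul_of_nonneg_right (hF' s hs).1 (sq_nonneg _)

/-- Second half of min-max. If the eigenspaces of `B` with eigenvalue at least `β'` spanned fewer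
dimensions than `W`, some nonzero `w ∈ W` would have `M w` orthogonal to them, hence form at most
`β'`; this contradicts `β' < β`. -/
theorem lambdaK_le_of_submodule (hc : 0 < c) (hT : ∀ u, M (T u) = c • (M u - B (M u)))
    (hB : IsCompactOperator B) (hsymm : (B : H →ₗ[ℝ] H).IsSymmetric)
    {β β' : ℝ} (hβ' : 0 < β') (hββ : β' < β) (W : Submodule ℝ H) [FiniteDimensional ℝ W]
    (hW : ∀ u ∈ W, β * ‖M u‖ ^ 2 ≤ inner ℝ (B (M u)) (M u)) :
    lambdaK T (finrank ℝ W) ≤ ((c * (1 - β') : ℝ) : EReal) := by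
  have hfin : {s : ℝ | HasEigenvalue (B : H →ₗ[ℝ] H) s ∧ β' ≤ s}.Finite :=
    (hB.finite_setOf_le_abs_eigenvalue hsymm hβ').subset fun s hs => ⟨hs.1, hs.2.trans (le_abs_self s)⟩
  let F' := hfin.toFinset
  have hF' : ∀ s, s ∈ F' ↔ HasEigenvalue (B : H →ₗ[ℝ] H) s ∧ β' ≤ s := fun s => by simp [F']
  let U : Submodule ℝ H := ⨆ s ∈ F', eigenspace (B : H →ₗ[ℝ] H) s
  obtain ⟨hUfin, hUdim⟩ := finrank_biSup_eigenspace (B := B) F' fun s hs =>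
    ContinuousLinearMap.finite_dimensional_eigenspace hB s (hβ'.trans_le ((hF' s).1 hs).2).ne'
  have hinj : Function.Injective fun s : ℝ => c * (1 - s) := by
    intro x y hxy
    simpa [hc.ne'] using hxy
  have hback : ∀ s : ℝ, 1 - c * (1 - s) / c = s := fun s => by field_simp; ring
  refine sInf_le (Set.mem_insert_of_mem _ ⟨_, rfl, F'.map ⟨_, hinj⟩, ?_, ?_⟩)
  · intro s hs
    obtain ⟨s, hs', rfl⟩ := Finset.mem_map.1 hs
    obtain ⟨h1, h2⟩ := (hF' s).1 hs'
    refine ⟨?_, ?_, ?_⟩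
    · rw [hasEigenvalue_iff_of_conj hc.ne' hT]
      simpa only [Function.Embedding.coeFn_mk, hback] using h1
    · simp only [Function.Embedding.coeFn_mk]
      gcongr
    · refine lt_of_lt_of_le (EReal.coe_lt_coe_iff.2 ?_) (le_lambdaInfty_of_conj hc hT hB hsymm)
      simp only [Function.Embedding.coeFn_mk]
      nlinarith
  · rw [Finset.sum_map]
    have : ∑ s ∈ F', eigenMult T ((⟨fun s : ℝ => c * (1 - s), hinj⟩ : ℝ ↪ ℝ) s) = finrank ℝ U := by
      rw [hUdim]
      refine Finset.sum_congr rfl fun s _ => ?_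
      rw [eigenMult_eq_of_conj hc.ne' hT, Function.Embedding.coeFn_mk, hback]
    rw [this]
    by_contra! hlt
    let L : W →ₗ[ℝ] U := (U.orthogonalProjectionOnto : H →ₗ[ℝ] U) ∘ₗ
      (M.toLinearEquiv : H →ₗ[ℝ] H) ∘ₗ W.subtype
    have hker : LinearMap.ker L ≠ ⊥ := LinearMap.ker_ne_bot_of_finrank_lt hlt
    obtain ⟨w, hw, hw0⟩ := Submodule.exists_mem_ne_zero_of_ne_bot hker
    have hw' : U.orthogonalProjectionOnto (M w) = 0 := hw
    have hperp : M w ∈ Uᗮ := Submodule.orthogonalProjectionOnto_eq_zero_iff.1 hw'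
    have h1 : inner ℝ (B (M w)) (M w) ≤ β' * ‖M w‖ ^ 2 := by
      refine hB.inner_le_of_mem_orthogonal hsymm fun s hs v hv => ?_
      by_cases hv0 : v = 0
      · rw [hv0, inner_zero_left]
      · have : s ∈ F' := (hF' s).2 ⟨hasEigenvalue_of_hasEigenvector ⟨hv, hv0⟩, hs⟩
        exact (Submodule.mem_orthogonal _ _).1 hperp v
          (le_biSup (fun s => eigenspace (B : H →ₗ[ℝ] H) s) this hv)
    have h2 := hW w w.2
    have h3 : 0 < ‖M (w : H)‖ := norm_pos_iff.2 (by simpa using hw0)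
    nlinarith [pow_pos h3 2]

end Conjugate

/-! ### Compactness of operators with square-integrable kernel. -/

section Carleman

variable {α H : Type*} [MeasurableSpace α] [NormedAddCommGroup H] [InnerProductSpace ℝ H]

/-- The operator `u ↦ ⟪Φ ·, u⟫` defined by a square-integrable `Φ` with values in a Hilbert space
is compact. -/
theorem isCompactOperator_compLpL₂_innerSL (μ : Measure α) (Φ : Lp H 2 μ) :
    IsCompactOperator
      (((innerSL ℝ : H →L[ℝ] H →L[ℝ] ℝ).flip.compLpL₂ 2 μ).flip Φ : H →L[ℝ] Lp ℝ 2 μ) := by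
  let L : Lp H 2 μ →L[ℝ] H →L[ℝ] Lp ℝ 2 μ :=
    ((innerSL ℝ : H →L[ℝ] H →L[ℝ] ℝ).flip.compLpL₂ 2 μ).flip
  have hL : ∀ Φ u, L Φ u =ᵐ[μ] fun x => inner ℝ (Φ x) u := fun Φ u =>
    ((innerSL ℝ : H →L[ℝ] H →L[ℝ] ℝ).flip u).coeFn_compLpL Φ
  change IsCompactOperator (L Φ)
  -- Indicators `Φ` give operators of rank at most one; compactness survives sums and limits in
  -- norm.
  refine Lp.induction (by norm_num) (motive := fun Φ => IsCompactOperator (L Φ)) ?_ ?_ ?_ Φ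
  · intro c s hs hμs
    set χ := Lp.simpleFunc.indicatorConst 2 hs hμs.ne c
    have : L χ = ((ContinuousLinearMap.toSpanSingleton ℝ
        (indicatorConstLp 2 hs hμs.ne (1 : ℝ))).comp (innerSL ℝ c)) := by
      ext1 u
      refine Lp.ext ((hL χ u).trans ?_)
      have e : (χ : Lp H 2 μ) = indicatorConstLp 2 hs hμs.ne c := rfl
      have h1 : (indicatorConstLp 2 hs hμs.ne c : α → H) =ᵐ[μ] _ := indicatorConstLp_coeFn
      have h2 : (indicatorConstLp 2 hs hμs.ne (1 : ℝ) : α → ℝ) =ᵐ[μ] _ := indicatorConstLp_coeFn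
      rw [e]
      filter_upwards [h1, h2, Lp.coeFn_smul (inner ℝ c u) (indicatorConstLp 2 hs hμs.ne (1 : ℝ))]
        with x h1 h2 h3
      rw [h1]
      refine Eq.trans ?_ h3.symm
      rw [Pi.smul_apply, h2]
      by_cases hx : x ∈ s <;> simp [hx]
    rw [this]
    exact (isCompactOperator_of_locallyCompactSpace_dom (innerSL ℝ c)).clm_comp
      (ContinuousLinearMap.toSpanSingleton ℝ _)
  · intro f g hf hg _ h1 h2
    rw [map_add]
    exact h1.add h2
  · exact isClosed_setOfPred_isCompactOperator.preimage L.continuous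

end Carleman

/-! ### The kernel `d(x, y) < ρ` and its quadratic form. -/

section NearKernel

variable {X : Type*} [MetricSpace X]

/-- The indicator function of `d(x, y) < ρ`. -/
def nearKernel (ρ : ℝ) (x y : X) : ℝ := (Metric.ball x ρ).indicator 1 y

theorem nearKernel_nonneg (ρ : ℝ) (x y : X) : 0 ≤ nearKernel ρ x y :=
  Set.indicator_nonneg (by simp) _

theorem nearKernel_le_one (ρ : ℝ) (x y : X) : nearKernel ρ x y ≤ 1 :=
  Set.indicator_le_self' (by simp) _

theorem nearKernel_comm (ρ : ℝ) (x y : X) : nearKernel ρ x y = nearKernel ρ y x := by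
  unfold nearKernel Set.indicator
  simp only [Metric.mem_ball, dist_comm, Pi.one_apply]

theorem abs_nearKernel_le_one (ρ : ℝ) (x y : X) : |nearKernel ρ x y| ≤ 1 := by
  rw [abs_of_nonneg (nearKernel_nonneg ρ x y)]; exact nearKernel_le_one ρ x y

end NearKernel

section BallForm

variable {X : Type*} [MetricSpace X] [MeasurableSpace X]

/-- The quadratic form `∫∫_{d(x, y) < ρ} u(x) u(y)`. -/
def ballForm (μ : Measure X) (ρ : ℝ) (u : X → ℝ) : ℝ :=
  ∫ x, (∫ y in Metric.ball x ρ, u y ∂μ) * u x ∂μ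

/-- The squared norm of `u` with respect to the measure with density `x ↦ μ (B_ρ(x))`. -/
def ballNormSq (μ : Measure X) (ρ : ℝ) (u : X → ℝ) : ℝ :=
  ∫ x, μ.real (Metric.ball x ρ) * u x ^ 2 ∂μ

variable [CompactSpace X] [BorelSpace X]

theorem measurable_nearKernel (ρ : ℝ) :
    Measurable fun p : X × X => nearKernel ρ p.1 p.2 := by
  have hS : MeasurableSet {p : X × X | dist p.2 p.1 < ρ} :=
    (isOpen_lt (by fun_prop) continuous_const).measurableSet
  exact (measurable_const (a := (1 : ℝ))).indicator hS

variable (μ : Measure X) [IsFiniteMeasure μ]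

theorem integral_nearKernel_mul (ρ : ℝ) (x : X) (u : X → ℝ) :
    ∫ y, nearKernel ρ x y * u y ∂μ = ∫ y in Metric.ball x ρ, u y ∂μ := by
  rw [← integral_indicator Metric.isOpen_ball.measurableSet]
  congr 1
  ext y
  by_cases h : y ∈ Metric.ball x ρ <;> simp [nearKernel, h]

theorem integral_nearKernel (ρ : ℝ) (x : X) :
    ∫ y, nearKernel ρ x y ∂μ = μ.real (Metric.ball x ρ) := by
  have := integral_nearKernel_mul μ ρ x fun _ => 1
  simpa using this

theorem measurable_measureReal_ball (ρ : ℝ) : Measurable fun x => μ.real (Metric.ball x ρ) := by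
  have hS : MeasurableSet {p : X × X | dist p.2 p.1 < ρ} :=
    (isOpen_lt (by fun_prop) continuous_const).measurableSet
  exact (measurable_measure_prodMk_left (ν := μ) hS).ennreal_toReal

variable {μ}

theorem integrable_nearKernel_mul_mul (ρ : ℝ) {u v : X → ℝ} (hu : Integrable u μ)
    (hv : Integrable v μ) :
    Integrable (fun p : X × X => nearKernel ρ p.1 p.2 * (v p.1 * u p.2)) (μ.prod μ) :=
  (hv.mul_prod hu).bdd_mul (measurable_nearKernel ρ).aestronglyMeasurable
    (Eventually.of_forall fun p => abs_nearKernel_le_one ρ p.1 p.2)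

theorem integral_ball_mul_eq_integral_prod (ρ : ℝ) {u v : X → ℝ} (hu : Integrable u μ)
    (hv : Integrable v μ) :
    ∫ x, (∫ y in Metric.ball x ρ, u y ∂μ) * v x ∂μ =
      ∫ p : X × X, nearKernel ρ p.1 p.2 * (v p.1 * u p.2) ∂(μ.prod μ) := by
  rw [integral_prod _ (integrable_nearKernel_mul_mul ρ hu hv)]
  refine integral_congr_ae (Eventually.of_forall fun x => ?_)
  simp only
  rw [← integral_nearKernel_mul, ← integral_mul_const]
  congr 1
  ext y
  ring

theorem ballForm_eq_integral_prod (ρ : ℝ) {u : X → ℝ} (hu : Integrable u μ) :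
    ballForm μ ρ u = ∫ p : X × X, nearKernel ρ p.1 p.2 * (u p.1 * u p.2) ∂(μ.prod μ) :=
  integral_ball_mul_eq_integral_prod ρ hu hu

theorem integral_ball_mul_comm (ρ : ℝ) {u v : X → ℝ} (hu : Integrable u μ) (hv : Integrable v μ) :
    ∫ x, (∫ y in Metric.ball x ρ, u y ∂μ) * v x ∂μ =
      ∫ x, (∫ y in Metric.ball x ρ, v y ∂μ) * u x ∂μ := by
  rw [integral_ball_mul_eq_integral_prod ρ hu hv, integral_ball_mul_eq_integral_prod ρ hv hu,
    ← integral_prod_swap]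
  refine integral_congr_ae (Eventually.of_forall fun p => ?_)
  simp only [Prod.fst_swap, Prod.snd_swap]
  rw [nearKernel_comm]
  ring

/-- Spheres may carry mass, so the map need not be continuous. It is the pointwise limit in L² of
the continuous maps obtained by replacing the indicator with continuous cutoffs increasing to it. -/
theorem stronglyMeasurable_indicatorConstLp_ball (μ : Measure X) [IsFiniteMeasure μ] (ρ : ℝ) :
    StronglyMeasurable fun x : X => indicatorConstLp 2 (Metric.isOpen_ball (x := x) (ε := ρ)).measurableSet
      (measure_ne_top μ _) (1 : ℝ) := by
  let g : ℕ → C(X × X, ℝ) := fun n =>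
    ⟨fun p => min 1 (max 0 (n * (ρ - dist p.2 p.1))), by fun_prop⟩
  refine stronglyMeasurable_of_tendsto (f := fun (n : ℕ) (x : X) =>
    ContinuousMap.toLp 2 μ ℝ ((g n).curry x)) atTop (fun n => ?_) ?_
  · exact ((ContinuousMap.toLp 2 μ ℝ).continuous.comp (g n).curry.continuous).stronglyMeasurable
  · refine tendsto_pi_nhds.2 fun x => ?_
    have hmeas : ∀ n, AEStronglyMeasurable ((g n).curry x) μ := fun n =>
      ((g n).curry x).continuous.aestronglyMeasurable
    rw [Lp.tendsto_Lp_iff_tendsto_eLpNorm']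
    have key := tendsto_Lp_finite_of_tendsto_ae (μ := μ) (p := 2) (f := fun n => (g n).curry x)
      (g := (Metric.ball x ρ).indicator fun _ => (1 : ℝ)) (by norm_num) (by norm_num) hmeas
      (memLp_indicator_const 2 Metric.isOpen_ball.measurableSet 1 (Or.inr (measure_ne_top μ _)))
      ?_ ?_
    · refine key.congr fun n => eLpNorm_congr_ae ?_
      have h1 : (indicatorConstLp 2 (Metric.isOpen_ball (x := x) (ε := ρ)).measurableSet
        (measure_ne_top μ _) (1 : ℝ) : X → ℝ) =ᵐ[μ] _ := indicatorConstLp_coeFn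
      filter_upwards [h1, ContinuousMap.coeFn_toLp (p := 2) (𝕜 := ℝ) μ ((g n).curry x)] with y h1 h2
      rw [Pi.sub_apply, Pi.sub_apply, h1, h2]
    -- The cutoffs are bounded by `1`, so the set where they reach `2` is empty.
    · refine unifIntegrable_of (by norm_num) (by norm_num) hmeas fun ε _ => ⟨2, fun n => ?_⟩
      have h0 : {y | (2 : NNReal) ≤ ‖(g n).curry x y‖₊} = ∅ := by
        refine Set.eq_empty_of_forall_notMem fun y hy => ?_
        have h1 : (2 : ℝ) ≤ ‖(g n).curry x y‖ := hy
        have h2 : ‖(g n).curry x y‖ ≤ 1 := by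
          rw [Real.norm_eq_abs, abs_le]
          exact ⟨(by norm_num : (-1 : ℝ) ≤ 0).trans (le_min zero_le_one (le_max_left _ _)),
            min_le_left _ _⟩
        linarith
      rw [h0, Set.indicator_empty]
      simp
    · refine Eventually.of_forall fun y => ?_
      by_cases hy : y ∈ Metric.ball x ρ
      · rw [Set.indicator_of_mem hy]
        have hy' : 0 < ρ - dist y x := sub_pos.2 hy
        refine tendsto_const_nhds.congr' ?_
        obtain ⟨N, hN⟩ := exists_nat_gt (1 / (ρ - dist y x))
        filter_upwards [eventually_ge_atTop N] with n hn
        have : 1 ≤ n * (ρ - dist y x) := by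
          rw [div_lt_iff₀ hy'] at hN
          have : (N : ℝ) ≤ n := by exact_mod_cast hn
          nlinarith
        simp [g, le_max_of_le_right this]
      · rw [Set.indicator_of_notMem hy]
        refine tendsto_const_nhds.congr fun n => ?_
        have : n * (ρ - dist y x) ≤ 0 :=
          mul_nonpos_of_nonneg_of_nonpos (Nat.cast_nonneg n) (by simpa using hy)
        simp [g, this]

end BallForm

/-! ### Multiplication operators on L². -/

section MulLp

variable {α : Type*} [MeasurableSpace α] {μ : Measure α}

/-- Multiplication by an essentially bounded function on `L²`. -/
def mulLp (w : α → ℝ) (hw : MemLp w ⊤ μ) : Lp ℝ 2 μ →L[ℝ] Lp ℝ 2 μ :=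
  (ContinuousLinearMap.mul ℝ ℝ).holderL μ ⊤ 2 2 hw.toLp

theorem mulLp_ae (w : α → ℝ) (hw : MemLp w ⊤ μ) (u : Lp ℝ 2 μ) :
    mulLp w hw u =ᵐ[μ] fun x => w x * u x := by
  have h1 : mulLp w hw u =ᵐ[μ] fun x => (hw.toLp w : Lp ℝ ⊤ μ) x * u x :=
    (ContinuousLinearMap.mul ℝ ℝ).coeFn_holder hw.toLp u
  filter_upwards [h1, hw.coeFn_toLp] with x h1 h2
  rw [h1, h2]

/-- Multiplication by a function with an essentially bounded inverse, as an automorphism of `L²`. -/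
def mulLpEquiv (w w' : α → ℝ) (hw : MemLp w ⊤ μ) (hw' : MemLp w' ⊤ μ)
    (h : ∀ᵐ x ∂μ, w x * w' x = 1) : Lp ℝ 2 μ ≃L[ℝ] Lp ℝ 2 μ :=
  ContinuousLinearEquiv.equivOfInverse (mulLp w hw) (mulLp w' hw')
    (fun u => Lp.ext (by
      filter_upwards [h, mulLp_ae w hw u, mulLp_ae w' hw' (mulLp w hw u)] with x h h1 h2
      rw [h2, h1, ← mul_assoc, mul_comm (w' x), h, one_mul]))
    (fun u => Lp.ext (by
      filter_upwards [h, mulLp_ae w' hw' u, mulLp_ae w hw (mulLp w' hw' u)] with x h h1 h2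
      rw [h2, h1, ← mul_assoc, h, one_mul]))

end MulLp

/-! ### From `λ_k` to subspaces on which the ball form is large. -/

section BallAverage

variable {X : Type*} [MetricSpace X] [MeasurableSpace X] [CompactSpace X] [BorelSpace X]
  (μ : Measure X) [IsFiniteMeasure μ] {ρ : ℝ}

/-- The averaging operator `u ↦ (x ↦ μ(B_ρ(x))⁻¹ ∫_{B_ρ(x)} u)`, that is, `1 - ρ² Δ^ρ`. -/
def ballAverage (ρ : ℝ) : Lp ℝ 2 μ →L[ℝ] Lp ℝ 2 μ := 1 - ρ ^ 2 • rhoLaplacian μ ρ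

theorem ballAverage_ae (hρ : 0 < ρ) (u : Lp ℝ 2 μ) :
    ∀ᵐ x ∂μ, ballAverage μ ρ u x =
      (μ.real (Metric.ball x ρ))⁻¹ * ∫ y in Metric.ball x ρ, u y ∂μ := by
  obtain ⟨c, hc, h⟩ := exists_ball_lower_bound μ hρ
  have hint : Integrable (u : X → ℝ) μ := (Lp.memLp u).integrable (by norm_num)
  filter_upwards [h, rhoLaplacian_ae μ ρ u, Lp.coeFn_sub u (ρ ^ 2 • rhoLaplacian μ ρ u),
    Lp.coeFn_smul (ρ ^ 2) (rhoLaplacian μ ρ u)] with x hx h1 h2 h3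
  have hm : 0 < μ.real (Metric.ball x ρ) := hc.trans_le hx
  change (u - ρ ^ 2 • rhoLaplacian μ ρ u : Lp ℝ 2 μ) x = _
  rw [h2, Pi.sub_apply, h3, Pi.smul_apply, h1,
    integral_sub (integrable_const _) hint.integrableOn]
  simp only [integral_const, measureReal_restrict_apply_univ, smul_eq_mul]
  field_simp
  ring

/-- The average at `x` is the inner product with `Φ x`, the normalized indicator of the ball; `Φ` is
essentially bounded because ball measures are bounded below almost everywhere. -/
theorem isCompactOperator_ballAverage (hρ : 0 < ρ) : IsCompactOperator (ballAverage μ ρ) := by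
  obtain ⟨c, hc, h⟩ := exists_ball_lower_bound μ hρ
  let Φ : X → Lp ℝ 2 μ := fun x => (μ.real (Metric.ball x ρ))⁻¹ •
    indicatorConstLp 2 (Metric.isOpen_ball (x := x) (ε := ρ)).measurableSet
      (measure_ne_top μ _) (1 : ℝ)
  have hΦm : StronglyMeasurable Φ :=
    (measurable_measureReal_ball μ ρ).inv.stronglyMeasurable.smul
      (stronglyMeasurable_indicatorConstLp_ball μ ρ)
  have hΦ : MemLp Φ 2 μ := by
    refine MemLp.of_bound hΦm.aestronglyMeasurable (c⁻¹ * √(μ.real Set.univ)) ?_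
    filter_upwards [h] with x hx
    rw [norm_smul, norm_indicatorConstLp (by norm_num) (by norm_num), norm_inv,
      Real.norm_of_nonneg (hc.le.trans hx), Real.sqrt_eq_rpow]
    simp only [norm_one, one_mul, ENNReal.toReal_ofNat]
    gcongr
    · exact measure_ne_top μ _
    · exact Set.subset_univ _
  have key : ballAverage μ ρ =
      ((innerSL ℝ : Lp ℝ 2 μ →L[ℝ] Lp ℝ 2 μ →L[ℝ] ℝ).flip.compLpL₂ 2 μ).flip hΦ.toLp := by
    ext1 u
    refine Lp.ext ?_
    have h1 : ((innerSL ℝ : Lp ℝ 2 μ →L[ℝ] Lp ℝ 2 μ →L[ℝ] ℝ).flip.compLpL₂ 2 μ).flip hΦ.toLp u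
        =ᵐ[μ] fun x => inner ℝ ((hΦ.toLp Φ : Lp (Lp ℝ 2 μ) 2 μ) x) u :=
      ((innerSL ℝ : Lp ℝ 2 μ →L[ℝ] Lp ℝ 2 μ →L[ℝ] ℝ).flip u).coeFn_compLpL hΦ.toLp
    filter_upwards [h1, ballAverage_ae μ hρ u, hΦ.coeFn_toLp] with x h1 h2 h3
    rw [h1, h2, h3, inner_smul_left, L2.inner_indicatorConstLp_one]
    rfl
  rw [key]
  exact isCompactOperator_compLpL₂_innerSL μ hΦ.toLp

/-- In the norm with density `μ(B_ρ(x))`, the `ρ`-Laplacian is an affine function of a compact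
symmetric operator, whose quadratic form is `ballForm`. -/
theorem exists_conj_rhoLaplacian (hρ : 0 < ρ) :
    ∃ (M : Lp ℝ 2 μ ≃L[ℝ] Lp ℝ 2 μ) (B : Lp ℝ 2 μ →L[ℝ] Lp ℝ 2 μ),
      IsCompactOperator B ∧ (B : Lp ℝ 2 μ →ₗ[ℝ] Lp ℝ 2 μ).IsSymmetric ∧
      (∀ u, M (rhoLaplacian μ ρ u) = (ρ ^ 2)⁻¹ • (M u - B (M u))) ∧
      (∀ u, ‖M u‖ ^ 2 = ballNormSq μ ρ u) ∧ (∀ u, inner ℝ (B (M u)) (M u) = ballForm μ ρ u) := by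
  obtain ⟨c, hc, h⟩ := exists_ball_lower_bound μ hρ
  -- Multiplication by the root of the ball measure identifies the weighted L² space with L²(μ). In
  -- the weighted inner product the normalization of the average cancels, leaving a symmetric
  -- kernel.
  let w : X → ℝ := fun x => √(μ.real (Metric.ball x ρ))
  have hwm : Measurable w := (measurable_measureReal_ball μ ρ).sqrt
  have hw : MemLp w ⊤ μ := by
    refine memLp_top_of_bound hwm.aestronglyMeasurable √(μ.real Set.univ)
      (Eventually.of_forall fun x => ?_)
    rw [Real.norm_of_nonneg (Real.sqrt_nonneg _)]
    exact Real.sqrt_le_sqrt (measureReal_mono (Set.subset_univ _))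
  have hw' : MemLp (fun x => (w x)⁻¹) ⊤ μ := by
    refine memLp_top_of_bound hwm.inv.aestronglyMeasurable (√c)⁻¹ ?_
    filter_upwards [h] with x hx
    rw [norm_inv, Real.norm_of_nonneg (Real.sqrt_nonneg _)]
    have := Real.sqrt_pos.2 hc
    gcongr
  have hww : ∀ᵐ x ∂μ, w x * (w x)⁻¹ = 1 := by
    filter_upwards [h] with x hx
    exact mul_inv_cancel₀ (Real.sqrt_pos.2 (hc.trans_le hx)).ne'
  let M := mulLpEquiv w (fun x => (w x)⁻¹) hw hw' hww
  have hM : ∀ u, M u =ᵐ[μ] fun x => w x * u x := mulLp_ae w hw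
  let B : Lp ℝ 2 μ →L[ℝ] Lp ℝ 2 μ :=
    (M : Lp ℝ 2 μ →L[ℝ] Lp ℝ 2 μ) ∘L ballAverage μ ρ ∘L (M.symm : Lp ℝ 2 μ →L[ℝ] Lp ℝ 2 μ)
  have hB : ∀ u, B (M u) = M (ballAverage μ ρ u) := fun u => by
    simp [B]
  have hform : ∀ u v, inner ℝ (B (M u)) (M v) =
      ∫ x, (∫ y in Metric.ball x ρ, u y ∂μ) * v x ∂μ := by
    intro u v
    rw [hB, L2.inner_def]
    refine integral_congr_ae ?_
    filter_upwards [hM (ballAverage μ ρ u), hM v, ballAverage_ae μ hρ u, h] with x h1 h2 h3 h4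
    have h5 : 0 < μ.real (Metric.ball x ρ) := hc.trans_le h4
    have h6 : w x * w x = μ.real (Metric.ball x ρ) := Real.mul_self_sqrt h5.le
    rw [h1, h2, h3]
    simp only [RCLike.inner_apply, conj_trivial]
    calc _ = (w x * w x) * (μ.real (Metric.ball x ρ))⁻¹ *
          ((∫ y in Metric.ball x ρ, u y ∂μ) * v x) := by ring
      _ = _ := by rw [h6, mul_inv_cancel₀ h5.ne', one_mul]
  have hint : ∀ u : Lp ℝ 2 μ, Integrable u μ := fun u => (Lp.memLp u).integrable (by norm_num)
  refine ⟨M, B, ?_, ?_, ?_, ?_, fun u => hform u u⟩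
  · exact ((isCompactOperator_ballAverage μ hρ).comp_clm
      (M.symm : Lp ℝ 2 μ →L[ℝ] Lp ℝ 2 μ)).clm_comp (M : Lp ℝ 2 μ →L[ℝ] Lp ℝ 2 μ)
  · intro u v
    obtain ⟨u, rfl⟩ := M.surjective u
    obtain ⟨v, rfl⟩ := M.surjective v
    change inner ℝ (B (M u)) (M v) = inner ℝ (M u) (B (M v))
    rw [real_inner_comm (B (M v)), hform, hform, integral_ball_mul_comm ρ (hint u) (hint v)]
  · intro u
    have hρ2 : ρ ^ 2 ≠ 0 := by positivity
    rw [hB, ← map_sub, ← map_smul]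
    congr 1
    change _ = (ρ ^ 2)⁻¹ • (u - (u - ρ ^ 2 • rhoLaplacian μ ρ u))
    rw [sub_sub_cancel, inv_smul_smul₀ hρ2]
  · intro u
    rw [← real_inner_self_eq_norm_sq, L2.inner_def]
    refine integral_congr_ae ?_
    filter_upwards [hM u] with x h1
    have h6 : w x * w x = μ.real (Metric.ball x ρ) := Real.mul_self_sqrt measureReal_nonneg
    rw [h1]
    simp only [RCLike.inner_apply, conj_trivial]
    rw [← h6]
    ring

/-- There is a `k`-dimensional subspace of `L²(X, μ)` on which the form `ballForm` is at least `a`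
times the squared norm `ballNormSq`. -/
def HasFormSubspace (μ : Measure X) (ρ : ℝ) (k : ℕ) (a : ℝ) : Prop :=
  ∃ W : Submodule ℝ (Lp ℝ 2 μ), Module.finrank ℝ W = k ∧
    ∀ u ∈ W, a * ballNormSq μ ρ u ≤ ballForm μ ρ u

/-- With `HasFormSubspace.mmLambda_le`, this replaces spectral bounds by a condition on two integral
forms that can be compared across spaces. -/
theorem hasFormSubspace_of_mmLambda_lt (hρ : 0 < ρ) {k : ℕ} {t : ℝ} (ht : t ≤ (ρ ^ 2)⁻¹)
    (h : mmLambda μ ρ k < t) : HasFormSubspace μ ρ k (1 - ρ ^ 2 * t) := by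
  obtain ⟨M, B, h1, h2, h3, h4, h5⟩ := exists_conj_rhoLaplacian μ hρ
  obtain ⟨W, hW, hWf⟩ := exists_submodule_of_lambdaK_lt (by positivity) h3 h1 h2 ht h
  refine ⟨W, hW, fun u hu => ?_⟩
  have := hWf u hu
  rwa [h4, h5, div_inv_eq_mul, mul_comm t] at this

variable {μ} in
theorem HasFormSubspace.mmLambda_le (hρ : 0 < ρ) {k : ℕ} (hk : 1 ≤ k) {a b : ℝ} (hb : 0 < b)
    (hba : b < a) (h : HasFormSubspace μ ρ k a) :
    mmLambda μ ρ k ≤ (((ρ ^ 2)⁻¹ * (1 - b) : ℝ) : EReal) := by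
  obtain ⟨M, B, h1, h2, h3, h4, h5⟩ := exists_conj_rhoLaplacian μ hρ
  obtain ⟨W, rfl, hWf⟩ := h
  -- `finrank` is `0` on infinite-dimensional spaces, so `1 ≤ k` is what gives finite dimension.
  have : FiniteDimensional ℝ W := Module.finite_of_finrank_pos hk
  refine lambdaK_le_of_submodule (by positivity) h3 h1 h2 hb hba W fun u hu => ?_
  rw [h4, h5]
  exact hWf u hu

end BallAverage

/-! ### Discretizing the forms by a partition of unity. -/

section Transport

variable {Y : Type*} [MetricSpace Y] [MeasurableSpace Y]

theorem ballForm_congr {ν : Measure Y} {ρ : ℝ} {u v : Y → ℝ} (h : u =ᵐ[ν] v) :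
    ballForm ν ρ u = ballForm ν ρ v := by
  refine integral_congr_ae ?_
  filter_upwards [h] with x hx
  rw [hx, integral_congr_ae (ae_restrict_of_ae h)]

theorem ballNormSq_congr {ν : Measure Y} {ρ : ℝ} {u v : Y → ℝ} (h : u =ᵐ[ν] v) :
    ballNormSq ν ρ u = ballNormSq ν ρ v := by
  refine integral_congr_ae ?_
  filter_upwards [h] with x hx
  rw [hx]

/-- Schur's test for a nonnegative symmetric kernel. -/
theorem integral_kernel_mul_le {α : Type*} [MeasurableSpace α] {ν : Measure α} [IsFiniteMeasure ν]
    {k : α → α → ℝ} (hk : Measurable fun p : α × α => k p.1 p.2) (hk0 : ∀ x y, 0 ≤ k x y)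
    (hsymm : ∀ x y, k x y = k y x) {C : ℝ} (hC : ∀ x y, k x y ≤ C) {ε : ℝ}
    (hε : ∀ x, ∫ y, k x y ∂ν ≤ ε) {w : α → ℝ} (hw : MemLp w 2 ν) :
    Integrable (fun p : α × α => k p.1 p.2 * (w p.1 * w p.2)) (ν.prod ν) ∧
    ∫ p : α × α, k p.1 p.2 * (w p.1 * w p.2) ∂(ν.prod ν) ≤ ε * ∫ x, w x ^ 2 ∂ν := by
  have hkC : ∀ᵐ p : α × α ∂(ν.prod ν), ‖k p.1 p.2‖ ≤ C := Eventually.of_forall fun p => by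
    rw [Real.norm_of_nonneg (hk0 _ _)]; exact hC _ _
  have hw1 : Integrable w ν := hw.integrable (by norm_num)
  have hw2 : Integrable (fun x => w x ^ 2) ν := hw.integrable_sq
  have i0 : Integrable (fun p : α × α => k p.1 p.2 * (w p.1 * w p.2)) (ν.prod ν) :=
    (hw1.mul_prod hw1).bdd_mul hk.aestronglyMeasurable hkC
  have i1 : Integrable (fun p : α × α => k p.1 p.2 * w p.1 ^ 2) (ν.prod ν) :=
    (hw2.comp_fst ν).bdd_mul hk.aestronglyMeasurable hkC
  have i2 : Integrable (fun p : α × α => k p.1 p.2 * w p.2 ^ 2) (ν.prod ν) :=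
    (hw2.comp_snd ν).bdd_mul hk.aestronglyMeasurable hkC
  refine ⟨i0, ?_⟩
  have e2 : ∫ p : α × α, k p.1 p.2 * w p.2 ^ 2 ∂(ν.prod ν) =
      ∫ p : α × α, k p.1 p.2 * w p.1 ^ 2 ∂(ν.prod ν) := by
    rw [← integral_prod_swap]
    refine integral_congr_ae (Eventually.of_forall fun p => ?_)
    simp only [Prod.fst_swap, Prod.snd_swap]
    rw [hsymm]
  have e1 : ∫ p : α × α, k p.1 p.2 * w p.1 ^ 2 ∂(ν.prod ν) ≤ ε * ∫ x, w x ^ 2 ∂ν := by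
    rw [integral_prod _ i1, ← integral_const_mul]
    refine integral_mono i1.integral_prod_left (hw2.const_mul ε) fun x => ?_
    simp only
    rw [integral_mul_const]
    exact mul_le_mul_of_nonneg_right (hε x) (sq_nonneg _)
  calc ∫ p : α × α, k p.1 p.2 * (w p.1 * w p.2) ∂(ν.prod ν)
      ≤ ∫ p : α × α, (1 / 2) * (k p.1 p.2 * w p.1 ^ 2 + k p.1 p.2 * w p.2 ^ 2) ∂(ν.prod ν) := by
        refine integral_mono i0 ((i1.add i2).const_mul _) fun p => ?_
        have := mul_nonneg (hk0 p.1 p.2) (sq_nonneg (w p.1 - w p.2))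
        simp only
        nlinarith
    _ = ∫ p : α × α, k p.1 p.2 * w p.1 ^ 2 ∂(ν.prod ν) := by
        rw [integral_const_mul, integral_add i1 i2, e2]; ring
    _ ≤ _ := e1

/-- Weighted Cauchy–Schwarz, from the discriminant of `t ↦ ∫ ψ (u - t)²`. -/
theorem sq_integral_mul_le {α : Type*} [MeasurableSpace α] {ν : Measure α}
    {ψ u : α → ℝ} (hψ0 : ∀ x, 0 ≤ ψ x) (h0 : Integrable ψ ν) (h1 : Integrable (fun x => ψ x * u x) ν)
    (h2 : Integrable (fun x => ψ x * u x ^ 2) ν) :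
    (∫ x, ψ x * u x ∂ν) ^ 2 ≤ (∫ x, ψ x ∂ν) * ∫ x, ψ x * u x ^ 2 ∂ν := by
  have key : ∀ t : ℝ, 0 ≤ (∫ x, ψ x ∂ν) * (t * t) + (-2 * ∫ x, ψ x * u x ∂ν) * t +
      ∫ x, ψ x * u x ^ 2 ∂ν := by
    intro t
    have e : ∫ x, ψ x * (u x - t) ^ 2 ∂ν = (∫ x, ψ x ∂ν) * (t * t) +
        (-2 * ∫ x, ψ x * u x ∂ν) * t + ∫ x, ψ x * u x ^ 2 ∂ν := by
      have j1 : Integrable (fun x => ψ x * (t * t)) ν := h0.mul_const _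
      have j2 : Integrable (fun x => -2 * (ψ x * u x) * t) ν := (h1.const_mul _).mul_const _
      have j3 : Integrable (fun x => ψ x * (t * t) + -2 * (ψ x * u x) * t) ν := j1.add j2
      rw [← integral_const_mul, ← integral_mul_const, ← integral_mul_const, ← integral_add j1 j2,
        ← integral_add j3 h2]
      congr 1
      ext x
      ring
    rw [← e]
    exact integral_nonneg fun x => mul_nonneg (hψ0 x) (sq_nonneg _)
  have := discrim_le_zero key
  unfold discrim at this
  nlinarith

variable [CompactSpace Y] [BorelSpace Y] {ι : Type*} [Fintype ι]

/-- The partition of unity `ψ` resolves the `ρ`-balls of `(Y, ν)` up to the error `ε`: on the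
supports of `ψ i` and `ψ j` the kernel of `ballForm` is `K i j` up to an error kernel with integrals
at most `ε`, and on the support of `ψ i` the measure of balls is `V i` up to `ε`. -/
structure BallApprox (ν : Measure Y) (ρ ε : ℝ) (K : ι → ι → ℝ) (V : ι → ℝ) (ψ : ι → Y → ℝ) :
    Prop where
  measurable : ∀ i, Measurable (ψ i)
  nonneg : ∀ i y, 0 ≤ ψ i y
  sum_eq_one : ∀ y, ∑ i, ψ i y = 1
  kernel : ∃ (h : Y → Y → ℝ) (C : ℝ), (Measurable fun p : Y × Y => h p.1 p.2) ∧
    (∀ x y, 0 ≤ h x y) ∧ (∀ x y, h x y = h y x) ∧ (∀ x y, h x y ≤ C) ∧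
    (∀ x, ∫ y, h x y ∂ν ≤ ε) ∧
    ∀ i j x y, ψ i x ≠ 0 → ψ j y ≠ 0 → |nearKernel ρ x y - K i j| ≤ h x y
  volume : ∀ i y, ψ i y ≠ 0 → |ν.real (Metric.ball y ρ) - V i| ≤ ε

namespace BallApprox

variable {ν : Measure Y} [IsFiniteMeasure ν] {ρ ε : ℝ} {K : ι → ι → ℝ} {V : ι → ℝ} {ψ : ι → Y → ℝ}

theorem le_one (h : BallApprox ν ρ ε K V ψ) (i : ι) (y : Y) : ψ i y ≤ 1 := by
  rw [← h.sum_eq_one y]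
  exact Finset.single_le_sum (fun j _ => h.nonneg j y) (Finset.mem_univ i)

theorem norm_le_one (h : BallApprox ν ρ ε K V ψ) (i : ι) (y : Y) : ‖ψ i y‖ ≤ 1 := by
  rw [Real.norm_of_nonneg (h.nonneg i y)]; exact h.le_one i y

theorem memLp (h : BallApprox ν ρ ε K V ψ) (i : ι) : MemLp (ψ i) 2 ν :=
  MemLp.of_bound (h.measurable i).aestronglyMeasurable 1 (Eventually.of_forall (h.norm_le_one i))

theorem integrable (h : BallApprox ν ρ ε K V ψ) (i : ι) : Integrable (ψ i) ν :=
  (h.memLp i).integrable (by norm_num)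

theorem integrable_mul (h : BallApprox ν ρ ε K V ψ) (i : ι) {u : Y → ℝ} (hu : Integrable u ν) :
    Integrable (fun y => ψ i y * u y) ν :=
  hu.bdd_mul (h.measurable i).aestronglyMeasurable (Eventually.of_forall (h.norm_le_one i))

theorem integral_eq_sum (h : BallApprox ν ρ ε K V ψ) {u : Y → ℝ} (hu : Integrable u ν) :
    ∫ y, u y ∂ν = ∑ i, ∫ y, ψ i y * u y ∂ν := by
  rw [← integral_finsetSum _ fun i _ => h.integrable_mul i hu]
  congr 1
  ext y
  rw [← Finset.sum_mul, h.sum_eq_one, one_mul]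

/-- Replacing the kernel by `K i j` on each product of supports costs at most the error kernel
pointwise, and Schur's test bounds the latter's form. -/
theorem abs_ballForm_sub_le (h : BallApprox ν ρ ε K V ψ) {u : ι → Y → ℝ}
    (hu : ∀ i, MemLp (u i) 2 ν) (hsupp : ∀ i y, u i y ≠ 0 → ψ i y ≠ 0) :
    |ballForm ν ρ (fun y => ∑ i, u i y) -
        ∑ i, ∑ j, K i j * ((∫ y, u i y ∂ν) * ∫ y, u j y ∂ν)| ≤
      ε * ∫ y, (∑ i, |u i y|) ^ 2 ∂ν := by
  obtain ⟨k, C, hk, hk0, hsymm, hC, hε, hkK⟩ := h.kernel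
  have hu1 : ∀ i, Integrable (u i) ν := fun i => (hu i).integrable (by norm_num)
  have hU : Integrable (fun y => ∑ i, u i y) ν := integrable_finsetSum _ fun i _ => hu1 i
  have hA : MemLp (fun y => ∑ i, |u i y|) 2 ν := memLp_finsetSum _ fun i _ => (hu i).abs
  obtain ⟨j1, j2⟩ := integral_kernel_mul_le hk hk0 hsymm hC hε hA
  have i1 : ∀ i j, Integrable (fun p : Y × Y => K i j * (u i p.1 * u j p.2)) (ν.prod ν) :=
    fun i j => ((hu1 i).mul_prod (hu1 j)).const_mul _
  have e1 : ∑ i, ∑ j, K i j * ((∫ y, u i y ∂ν) * ∫ y, u j y ∂ν) =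
      ∫ p : Y × Y, ∑ i, ∑ j, K i j * (u i p.1 * u j p.2) ∂(ν.prod ν) := by
    rw [integral_finsetSum _ fun i _ => integrable_finsetSum _ fun j _ => i1 i j]
    refine Finset.sum_congr rfl fun i _ => ?_
    rw [integral_finsetSum _ fun j _ => i1 i j]
    refine Finset.sum_congr rfl fun j _ => ?_
    rw [integral_const_mul, integral_prod_mul]
  rw [ballForm_eq_integral_prod ρ hU, e1, ← integral_sub (integrable_nearKernel_mul_mul ρ hU hU)
    (integrable_finsetSum _ fun i _ => integrable_finsetSum _ fun j _ => i1 i j)]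
  refine le_trans ?_ j2
  rw [← Real.norm_eq_abs]
  refine norm_integral_le_of_norm_le j1 (Eventually.of_forall fun p => ?_)
  have e2 : nearKernel ρ p.1 p.2 * ((∑ i, u i p.1) * ∑ j, u j p.2) -
      ∑ i, ∑ j, K i j * (u i p.1 * u j p.2) =
      ∑ i, ∑ j, (nearKernel ρ p.1 p.2 - K i j) * (u i p.1 * u j p.2) := by
    rw [Finset.sum_mul_sum]
    simp only [sub_mul, Finset.sum_sub_distrib, Finset.mul_sum]
  rw [e2, Finset.sum_mul_sum, Finset.mul_sum]
  refine (norm_sum_le _ _).trans (Finset.sum_le_sum fun i _ => ?_)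
  rw [Finset.mul_sum]
  refine (norm_sum_le _ _).trans (Finset.sum_le_sum fun j _ => ?_)
  rw [norm_mul, norm_mul, Real.norm_eq_abs, Real.norm_eq_abs, Real.norm_eq_abs]
  by_cases hi : u i p.1 = 0
  · simp [hi]
  by_cases hj : u j p.2 = 0
  · simp [hj]
  exact mul_le_mul_of_nonneg_right (hkK i j _ _ (hsupp i _ hi) (hsupp j _ hj)) (by positivity)

/-- Jensen's inequality for the weights `ψ i y`. -/
theorem sq_sum_mul_le (h : BallApprox ν ρ ε K V ψ) (b : ι → ℝ) (y : Y) :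
    (∑ i, b i * ψ i y) ^ 2 ≤ ∑ i, b i ^ 2 * ψ i y := by
  have := (even_two.convexOn_pow (𝕜 := ℝ)).map_sum_le (t := Finset.univ)
    (w := fun i => ψ i y) (p := b) (fun i _ => h.nonneg i y) (h.sum_eq_one y) (fun i _ => Set.mem_univ _)
  simpa only [smul_eq_mul, mul_comm] using this

end BallApprox

end Transport

/-! ### Transport of functions between two spaces with the same discretization. -/

section TransportMap

variable {Y₁ Y₂ : Type*} [MetricSpace Y₁] [MeasurableSpace Y₁] [CompactSpace Y₁] [BorelSpace Y₁]
  [MetricSpace Y₂] [MeasurableSpace Y₂] [CompactSpace Y₂] [BorelSpace Y₂]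
  {ν₁ : Measure Y₁} [IsFiniteMeasure ν₁] {ν₂ : Measure Y₂} [IsFiniteMeasure ν₂]
  {ι : Type*} [Fintype ι] {ρ ε : ℝ} {K : ι → ι → ℝ} {V : ι → ℝ} {ψ₁ : ι → Y₁ → ℝ} {ψ₂ : ι → Y₂ → ℝ}

/-- The map `u ↦ ∑ i, (∫ ψ₁ i u / ∫ ψ₂ i) ψ₂ i` from `L²(Y₁)` to `L²(Y₂)`. -/
def BallApprox.transport (h₁ : BallApprox ν₁ ρ ε K V ψ₁) (h₂ : BallApprox ν₂ ρ ε K V ψ₂) :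
    Lp ℝ 2 ν₁ →ₗ[ℝ] Lp ℝ 2 ν₂ :=
  ∑ i, (innerₗ (Lp ℝ 2 ν₁) ((h₁.memLp i).toLp (ψ₁ i))).smulRight
    ((∫ y, ψ₂ i y ∂ν₂)⁻¹ • (h₂.memLp i).toLp (ψ₂ i))

theorem BallApprox.transport_ae (h₁ : BallApprox ν₁ ρ ε K V ψ₁) (h₂ : BallApprox ν₂ ρ ε K V ψ₂)
    (u : Lp ℝ 2 ν₁) : h₁.transport h₂ u =ᵐ[ν₂]
      fun y => ∑ i, (∫ x, ψ₁ i x * u x ∂ν₁) * (∫ y, ψ₂ i y ∂ν₂)⁻¹ * ψ₂ i y := by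
  have e : h₁.transport h₂ u = ∑ i, ((∫ x, ψ₁ i x * u x ∂ν₁) * (∫ y, ψ₂ i y ∂ν₂)⁻¹) •
      (h₂.memLp i).toLp (ψ₂ i) := by
    simp only [transport, LinearMap.sum_apply, LinearMap.smulRight_apply, innerₗ_apply_apply,
      smul_smul]
    refine Finset.sum_congr rfl fun i _ => ?_
    congr 2
    rw [L2.inner_def]
    refine integral_congr_ae ?_
    filter_upwards [(h₁.memLp i).coeFn_toLp] with x hx
    rw [hx]
    simp [mul_comm]
  rw [e]
  refine (Lp.coeFn_finsetSum _ _).trans ?_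
  have h1 : ∀ᵐ y ∂ν₂, ∀ i, (((∫ x, ψ₁ i x * u x ∂ν₁) * (∫ y, ψ₂ i y ∂ν₂)⁻¹) •
      (h₂.memLp i).toLp (ψ₂ i) : Lp ℝ 2 ν₂) y =
      (∫ x, ψ₁ i x * u x ∂ν₁) * (∫ y, ψ₂ i y ∂ν₂)⁻¹ * ψ₂ i y := by
    refine ae_all_iff.2 fun i => ?_
    filter_upwards [Lp.coeFn_smul ((∫ x, ψ₁ i x * u x ∂ν₁) * (∫ y, ψ₂ i y ∂ν₂)⁻¹)
      ((h₂.memLp i).toLp (ψ₂ i)), (h₂.memLp i).coeFn_toLp] with y h1 h2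
    rw [h1, Pi.smul_apply, h2, smul_eq_mul]
  filter_upwards [h1] with y h1
  rw [Finset.sum_apply]
  exact Finset.sum_congr rfl fun i _ => h1 i

/-- Both functions have the same cell integrals, hence the same discretized form; the loss `(2 + ε)
ε` is `ε` in the source plus `ε (1 + ε)` in the target. For the norm, Jensen in the target, `hm` and
Cauchy–Schwarz in the source apply; `2 ε` collects one volume error from each space. -/
theorem BallApprox.transport_estimates (h₁ : BallApprox ν₁ ρ ε K V ψ₁)
    (h₂ : BallApprox ν₂ ρ ε K V ψ₂) (hε : 0 ≤ ε) (hV : ∀ i, 0 ≤ V i)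
    (hm : ∀ i, ∫ y, ψ₁ i y ∂ν₁ ≤ (1 + ε) * ∫ y, ψ₂ i y ∂ν₂) (u : Lp ℝ 2 ν₁) :
    ballNormSq ν₂ ρ (h₁.transport h₂ u) ≤
      (1 + ε) * (ballNormSq ν₁ ρ u + 2 * ε * ∫ y, u y ^ 2 ∂ν₁) ∧
    ballForm ν₁ ρ u - (2 + ε) * ε * ∫ y, u y ^ 2 ∂ν₁ ≤ ballForm ν₂ ρ (h₁.transport h₂ u) := by
  have hu : MemLp u 2 ν₁ := Lp.memLp u
  have hu1 : Integrable u ν₁ := hu.integrable (by norm_num)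
  have hu2 : Integrable (fun y => u y ^ 2) ν₁ := hu.integrable_sq
  rw [ballForm_congr (h₁.transport_ae h₂ u), ballNormSq_congr (h₁.transport_ae h₂ u)]
  set a : ι → ℝ := fun i => ∫ x, ψ₁ i x * u x ∂ν₁ with ha
  set m : ι → ℝ := fun i => ∫ y, ψ₂ i y ∂ν₂ with hmdef
  set q : ι → ℝ := fun i => ∫ x, ψ₁ i x * u x ^ 2 ∂ν₁ with hq
  set b : ι → ℝ := fun i => a i * (m i)⁻¹ with hb
  have hm0 : ∀ i, 0 ≤ m i := fun i => integral_nonneg (h₂.nonneg i)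
  have hq0 : ∀ i, 0 ≤ q i := fun i =>
    integral_nonneg fun x => mul_nonneg (h₁.nonneg i x) (sq_nonneg _)
  have haq : ∀ i, a i ^ 2 ≤ (1 + ε) * m i * q i := fun i =>
    (sq_integral_mul_le (h₁.nonneg i) (h₁.integrable i) (h₁.integrable_mul i hu1)
      (h₁.integrable_mul i hu2)).trans (mul_le_mul_of_nonneg_right (hm i) (hq0 i))
  -- A cell with `m i = 0` has `a i = 0` by `haq`, so the convention `0⁻¹ = 0` loses nothing.
  have hbm : ∀ i, b i * m i = a i := by
    intro i
    rcases (hm0 i).eq_or_lt with h | h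
    · have h1 := haq i
      rw [← h, mul_zero, zero_mul] at h1
      have h2 : a i = 0 := pow_eq_zero_iff two_ne_zero |>.1 (le_antisymm h1 (sq_nonneg _))
      rw [← h, h2, mul_zero]
    · exact inv_mul_cancel_right₀ h.ne' _
  have hbq : ∀ i, b i ^ 2 * m i ≤ (1 + ε) * q i := by
    intro i
    rcases (hm0 i).eq_or_lt with h | h
    · rw [← h, mul_zero]
      exact mul_nonneg (by linarith) (hq0 i)
    · have h1 := haq i
      rw [← hbm i] at h1
      refine le_of_mul_le_mul_right ?_ h
      linarith
  have hqsum : ∑ i, q i = ∫ y, u y ^ 2 ∂ν₁ := (h₁.integral_eq_sum hu2).symm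
  have hψ2 : ∀ c : ι → ℝ, Integrable (fun y => ∑ i, c i * ψ₂ i y) ν₂ := fun c =>
    integrable_finsetSum _ fun i _ => (h₂.integrable i).const_mul _
  constructor
  · have hVb : ∀ y, ‖ν₁.real (Metric.ball y ρ)‖ ≤ ν₁.real Set.univ := fun y => by
      rw [Real.norm_of_nonneg measureReal_nonneg]; exact measureReal_mono (Set.subset_univ _)
    have iN : Integrable (fun y => ν₁.real (Metric.ball y ρ) * u y ^ 2) ν₁ :=
      hu2.bdd_mul (measurable_measureReal_ball ν₁ ρ).aestronglyMeasurable (Eventually.of_forall hVb)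
    have iN' : Integrable (fun y => (ν₁.real (Metric.ball y ρ) + 2 * ε) * u y ^ 2) ν₁ :=
      (iN.add (hu2.const_mul (2 * ε))).congr (Eventually.of_forall fun y => by
        simp only [Pi.add_apply, add_mul])
    have s1 : ballNormSq ν₂ ρ (fun y => ∑ i, b i * ψ₂ i y) ≤ ∑ i, (V i + ε) * (b i ^ 2 * m i) := by
      have e : ∑ i, (V i + ε) * (b i ^ 2 * m i) =
          ∫ y, ∑ i, ((V i + ε) * b i ^ 2) * ψ₂ i y ∂ν₂ := by
        rw [integral_finsetSum _ fun i _ => (h₂.integrable i).const_mul _]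
        refine Finset.sum_congr rfl fun i _ => ?_
        rw [integral_const_mul]
        ring
      rw [e]
      refine integral_mono_of_nonneg (Eventually.of_forall fun y =>
        mul_nonneg measureReal_nonneg (sq_nonneg _)) (hψ2 _) (Eventually.of_forall fun y => ?_)
      refine (mul_le_mul_of_nonneg_left (h₂.sq_sum_mul_le b y) measureReal_nonneg).trans ?_
      rw [Finset.mul_sum]
      refine Finset.sum_le_sum fun i _ => ?_
      by_cases h0 : ψ₂ i y = 0
      · simp [h0]
      have h1 := (abs_le.1 (h₂.volume i y h0)).2
      have h2 := mul_nonneg (sq_nonneg (b i)) (h₂.nonneg i y)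
      nlinarith
    have s2 : ∑ i, (V i + ε) * q i ≤ ballNormSq ν₁ ρ u + 2 * ε * ∫ y, u y ^ 2 ∂ν₁ := by
      have e : ballNormSq ν₁ ρ u + 2 * ε * ∫ y, u y ^ 2 ∂ν₁ =
          ∑ i, ∫ y, ψ₁ i y * ((ν₁.real (Metric.ball y ρ) + 2 * ε) * u y ^ 2) ∂ν₁ := by
        rw [← h₁.integral_eq_sum iN', ballNormSq, ← integral_const_mul,
          ← integral_add iN (hu2.const_mul _)]
        simp only [add_mul]
      rw [e]
      refine Finset.sum_le_sum fun i _ => ?_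
      rw [hq, ← integral_const_mul]
      refine integral_mono ((h₁.integrable_mul i hu2).const_mul _) (h₁.integrable_mul i iN')
        fun y => ?_
      by_cases h0 : ψ₁ i y = 0
      · simp [h0]
      have h1 := (abs_le.1 (h₁.volume i y h0)).1
      have h2 := mul_nonneg (h₁.nonneg i y) (sq_nonneg (u y))
      simp only
      nlinarith
    calc _ ≤ ∑ i, (V i + ε) * (b i ^ 2 * m i) := s1
      _ ≤ ∑ i, (V i + ε) * ((1 + ε) * q i) := Finset.sum_le_sum fun i _ =>
          mul_le_mul_of_nonneg_left (hbq i) (add_nonneg (hV i) hε)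
      _ = (1 + ε) * ∑ i, (V i + ε) * q i := by
          rw [Finset.mul_sum]; exact Finset.sum_congr rfl fun i _ => by ring
      _ ≤ _ := mul_le_mul_of_nonneg_left s2 (by linarith)
  · have t1 := h₁.abs_ballForm_sub_le (u := fun i y => ψ₁ i y * u y)
      (fun i => hu.mono ((h₁.measurable i).aestronglyMeasurable.mul hu.1)
        (Eventually.of_forall fun y => by
          rw [norm_mul]
          exact mul_le_of_le_one_left (norm_nonneg _) (h₁.norm_le_one i y))) fun i y h0 => left_ne_zero_of_mul h0
    have t2 := h₂.abs_ballForm_sub_le (u := fun i y => b i * ψ₂ i y)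
      (fun i => (h₂.memLp i).const_mul _) fun i y h0 => right_ne_zero_of_mul h0
    have e1 : (fun y => ∑ i, ψ₁ i y * u y) = u := by
      ext y; rw [← Finset.sum_mul, h₁.sum_eq_one, one_mul]
    have e2 : ∀ y, ∑ i, |ψ₁ i y * u y| = |u y| := fun y => by
      simp only [abs_mul, abs_of_nonneg (h₁.nonneg _ y)]
      rw [← Finset.sum_mul, h₁.sum_eq_one, one_mul]
    have e3 : ∀ i, ∫ y, b i * ψ₂ i y ∂ν₂ = a i := fun i => by
      rw [integral_const_mul]; exact hbm i
    simp only [e1, e2, sq_abs] at t1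
    simp only [e3] at t2
    have t3 : ∫ y, (∑ i, |b i * ψ₂ i y|) ^ 2 ∂ν₂ ≤ (1 + ε) * ∫ y, u y ^ 2 ∂ν₁ := by
      calc ∫ y, (∑ i, |b i * ψ₂ i y|) ^ 2 ∂ν₂ ≤ ∫ y, ∑ i, b i ^ 2 * ψ₂ i y ∂ν₂ := by
            refine integral_mono_of_nonneg (Eventually.of_forall fun y => sq_nonneg _) (hψ2 _)
              (Eventually.of_forall fun y => ?_)
            have := h₂.sq_sum_mul_le (fun i => |b i|) y
            simp only [sq_abs] at this
            simpa only [abs_mul, abs_of_nonneg (h₂.nonneg _ y)] using this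
        _ = ∑ i, b i ^ 2 * m i := by
            rw [integral_finsetSum _ fun i _ => (h₂.integrable i).const_mul _]
            exact Finset.sum_congr rfl fun i _ => integral_const_mul _ _
        _ ≤ ∑ i, (1 + ε) * q i := Finset.sum_le_sum fun i _ => hbq i
        _ = _ := by rw [← Finset.mul_sum, hqsum]
    have t4 := mul_le_mul_of_nonneg_left t3 hε
    have t5 := (abs_le.1 t1).2
    have t6 := (abs_le.1 t2).1
    change _ ≤ ballForm ν₂ ρ fun y => ∑ i, b i * ψ₂ i y
    linarith

/-- Subspaces on which `ballForm` is large are carried from one space to another by `transport`. -/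
theorem HasFormSubspace.transport (h₁ : BallApprox ν₁ ρ ε K V ψ₁)
    (h₂ : BallApprox ν₂ ρ ε K V ψ₂) (hε : 0 ≤ ε) (hV : ∀ i, 0 ≤ V i)
    (hm : ∀ i, ∫ y, ψ₁ i y ∂ν₁ ≤ (1 + ε) * ∫ y, ψ₂ i y ∂ν₂) {c : ℝ} (hc : 0 < c)
    (hcV : ∀ y, c ≤ ν₁.real (Metric.ball y ρ)) {k : ℕ} {a b : ℝ} (hb : 0 < b)
    (hab : b * ((1 + ε) * (1 + 2 * ε / c)) ≤ a - (2 + ε) * ε / c)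
    (h : HasFormSubspace ν₁ ρ k a) : HasFormSubspace ν₂ ρ k b := by
  obtain ⟨W, hWk, hW⟩ := h
  have key : ∀ u ∈ W, b * ballNormSq ν₂ ρ (h₁.transport h₂ u) ≤ ballForm ν₂ ρ (h₁.transport h₂ u) ∧
      b * ballNormSq ν₁ ρ u ≤ ballForm ν₂ ρ (h₁.transport h₂ u) ∧
      c * ∫ y, u y ^ 2 ∂ν₁ ≤ ballNormSq ν₁ ρ u := by
    intro u hu
    obtain ⟨j1, j2⟩ := h₁.transport_estimates h₂ hε hV hm u
    have hu2 : Integrable (fun y => u y ^ 2) ν₁ := (Lp.memLp u).integrable_sq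
    have hVb : ∀ y, ‖ν₁.real (Metric.ball y ρ)‖ ≤ ν₁.real Set.univ := fun y => by
      rw [Real.norm_of_nonneg measureReal_nonneg]; exact measureReal_mono (Set.subset_univ _)
    have iN : Integrable (fun y => ν₁.real (Metric.ball y ρ) * u y ^ 2) ν₁ :=
      hu2.bdd_mul (measurable_measureReal_ball ν₁ ρ).aestronglyMeasurable (Eventually.of_forall hVb)
    have j3 : c * ∫ y, u y ^ 2 ∂ν₁ ≤ ballNormSq ν₁ ρ u := by
      rw [← integral_const_mul]
      exact integral_mono (hu2.const_mul c) iN fun y =>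
        mul_le_mul_of_nonneg_right (hcV y) (sq_nonneg _)
    have j4 := hW u hu
    set S := ∫ y, u y ^ 2 ∂ν₁
    set N := ballNormSq ν₁ ρ u
    have hS : 0 ≤ S := integral_nonneg fun y => sq_nonneg _
    have hN : 0 ≤ N := (mul_nonneg hc.le hS).trans j3
    -- The lower bound on ball measures lets the norm `N` absorb the errors, which are multiples of
    -- `S`.
    have hSN : S ≤ N / c := by rw [le_div_iff₀ hc]; linarith
    have j5 : (a - (2 + ε) * ε / c) * N ≤ ballForm ν₂ ρ (h₁.transport h₂ u) := by
      have : (2 + ε) * ε * S ≤ (2 + ε) * ε * (N / c) := by gcongr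
      calc _ = a * N - (2 + ε) * ε * (N / c) := by ring
        _ ≤ _ := by linarith
    have j6 := (mul_le_mul_of_nonneg_right hab hN).trans j5
    refine ⟨?_, ?_, j3⟩
    · refine le_trans ?_ j6
      calc _ ≤ b * ((1 + ε) * (N + 2 * ε * S)) := by gcongr
        _ ≤ b * ((1 + ε) * (N + 2 * ε * (N / c))) := by gcongr
        _ = _ := by ring
    · refine le_trans ?_ j6
      have h0 : 0 ≤ 2 * ε / c := by positivity
      have : 1 ≤ (1 + ε) * (1 + 2 * ε / c) := by nlinarith [mul_nonneg hε h0]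
      calc _ = b * 1 * N := by ring
        _ ≤ _ := by gcongr
  -- If the image vanishes, the second and third bounds of `key` and `b > 0` force `∫ u² = 0`. So
  -- the dimension is preserved.
  have hinj : Function.Injective ((h₁.transport h₂).domRestrict W) := by
    rw [← LinearMap.ker_eq_bot, LinearMap.ker_eq_bot']
    rintro ⟨u, hu⟩ h0
    have h0' : h₁.transport h₂ u = 0 := h0
    obtain ⟨-, k1, k2⟩ := key u hu
    have hz : ballForm ν₂ ρ (h₁.transport h₂ u) = 0 := by
      rw [h0', ballForm_congr (Lp.coeFn_zero ℝ 2 ν₂)]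
      simp [ballForm]
    rw [hz] at k1
    have hS0 : 0 ≤ ∫ y, u y ^ 2 ∂ν₁ := integral_nonneg fun y => sq_nonneg _
    have hS : ∫ y, u y ^ 2 ∂ν₁ = 0 := by
      have hN : ballNormSq ν₁ ρ u ≤ 0 := by
        by_contra! hlt
        nlinarith [mul_pos hb hlt]
      refine le_antisymm ?_ hS0
      by_contra! hlt
      nlinarith [mul_pos hc hlt]
    have : ‖u‖ ^ 2 = 0 := by
      rw [← real_inner_self_eq_norm_sq, L2.inner_def, ← hS]
      refine integral_congr_ae (Eventually.of_forall fun y => ?_)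
      simp [sq]
    rw [Subtype.ext_iff]
    exact norm_eq_zero.1 (pow_eq_zero_iff two_ne_zero |>.1 this)
  refine ⟨W.map (h₁.transport h₂), ?_, ?_⟩
  · rw [← hWk, ← LinearMap.finrank_range_of_inj hinj, LinearMap.range_domRestrict]
  · rintro _ ⟨u, hu, rfl⟩
    exact (key u hu).1

end TransportMap

/-! ### Lipschitz profiles for the jump at distance `ρ`. -/

section Profiles

/-- The truncation of a real number to `[0, 1]`. -/
def clampUnit (t : ℝ) : ℝ := max 0 (min 1 t)

theorem clampUnit_nonneg (t : ℝ) : 0 ≤ clampUnit t := le_max_left _ _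

theorem clampUnit_le_one (t : ℝ) : clampUnit t ≤ 1 := max_le zero_le_one (min_le_left _ _)

theorem clampUnit_of_one_le {t : ℝ} (h : 1 ≤ t) : clampUnit t = 1 := by
  rw [clampUnit, min_eq_left h, max_eq_right zero_le_one]

theorem clampUnit_of_nonpos {t : ℝ} (h : t ≤ 0) : clampUnit t = 0 := by
  rw [clampUnit, max_eq_left ((min_le_right _ _).trans h)]

theorem abs_clampUnit_sub_le (s t : ℝ) : |clampUnit s - clampUnit t| ≤ |s - t| := by
  unfold clampUnit
  refine (abs_max_sub_max_le_max _ _ _ _).trans ?_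
  rw [sub_self, abs_zero, max_eq_right (abs_nonneg _)]
  refine (abs_min_sub_min_le_max _ _ _ _).trans ?_
  rw [sub_self, abs_zero, max_eq_right (abs_nonneg _)]

theorem continuous_clampUnit : Continuous clampUnit := by unfold clampUnit; fun_prop

/-- A Lipschitz approximation of the indicator function of `(-∞, ρ)`. -/
def cutProfile (ρ δ s : ℝ) : ℝ := clampUnit ((ρ - s) / δ)

/-- A Lipschitz bump function around `ρ`. -/
def bumpProfile (ρ δ s : ℝ) : ℝ := clampUnit (2 - |s - ρ| / δ)

theorem continuous_cutProfile (ρ δ : ℝ) : Continuous (cutProfile ρ δ) :=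
  continuous_clampUnit.comp (by fun_prop)

theorem continuous_bumpProfile (ρ δ : ℝ) : Continuous (bumpProfile ρ δ) :=
  continuous_clampUnit.comp (by fun_prop)

theorem abs_cutProfile_sub_le (ρ : ℝ) {δ : ℝ} (hδ : 0 < δ) (s t : ℝ) :
    |cutProfile ρ δ s - cutProfile ρ δ t| ≤ |s - t| / δ := by
  refine (abs_clampUnit_sub_le _ _).trans_eq ?_
  rw [← sub_div, abs_div, abs_of_pos hδ, sub_sub_sub_cancel_left, abs_sub_comm]

theorem abs_bumpProfile_sub_le (ρ : ℝ) {δ : ℝ} (hδ : 0 < δ) (s t : ℝ) :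
    |bumpProfile ρ δ s - bumpProfile ρ δ t| ≤ |s - t| / δ := by
  refine (abs_clampUnit_sub_le _ _).trans ?_
  rw [sub_sub_sub_cancel_left, ← sub_div, abs_div, abs_of_pos hδ]
  refine div_le_div_of_nonneg_right ?_ hδ.le
  refine (abs_abs_sub_abs_le (t - ρ) (s - ρ)).trans_eq ?_
  rw [sub_sub_sub_cancel_right, abs_sub_comm]

theorem bumpProfile_of_abs_sub_le {ρ δ s : ℝ} (hδ : 0 < δ) (h : |s - ρ| ≤ δ) :
    bumpProfile ρ δ s = 1 := by
  refine clampUnit_of_one_le ?_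
  have := (div_le_one hδ).2 h
  linarith

theorem bumpProfile_of_le_abs_sub {ρ δ s : ℝ} (hδ : 0 < δ) (h : 2 * δ ≤ |s - ρ|) :
    bumpProfile ρ δ s = 0 := by
  refine clampUnit_of_nonpos ?_
  have := (le_div_iff₀ hδ).2 h
  linarith

theorem cutProfile_of_le {ρ δ s : ℝ} (hδ : 0 < δ) (h : s ≤ ρ - δ) : cutProfile ρ δ s = 1 :=
  clampUnit_of_one_le ((one_le_div hδ).2 (by linarith))

theorem cutProfile_of_ge {ρ δ s : ℝ} (hδ : 0 < δ) (h : ρ ≤ s) : cutProfile ρ δ s = 0 :=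
  clampUnit_of_nonpos (div_nonpos_of_nonpos_of_nonneg (by linarith) hδ.le)

/-- The two can differ only when `s` is within `δ` of `ρ`, where the bump equals `1`. -/
theorem abs_nearKernel_sub_cutProfile_le {Y : Type*} [MetricSpace Y] {ρ δ s : ℝ} (hδ : 0 < δ)
    {y z : Y} (h : |s - dist y z| ≤ δ) :
    |nearKernel ρ y z - cutProfile ρ δ s| ≤ bumpProfile ρ δ s := by
  obtain ⟨h1, h2⟩ := abs_le.1 h
  have hc0 : 0 ≤ cutProfile ρ δ s := clampUnit_nonneg _
  have hc1 : cutProfile ρ δ s ≤ 1 := clampUnit_le_one _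
  have hb0 : 0 ≤ bumpProfile ρ δ s := clampUnit_nonneg _
  have hmid : |s - ρ| ≤ δ →
      |nearKernel ρ y z - cutProfile ρ δ s| ≤ bumpProfile ρ δ s := fun hs => by
    rw [bumpProfile_of_abs_sub_le hδ hs]
    have := nearKernel_nonneg ρ y z
    have := nearKernel_le_one ρ y z
    exact abs_le.2 ⟨by linarith, by linarith⟩
  by_cases hz : z ∈ Metric.ball y ρ
  · have e : nearKernel ρ y z = 1 := by simp only [nearKernel, Set.indicator_of_mem hz, Pi.one_apply]
    rw [Metric.mem_ball, dist_comm] at hz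
    rcases le_total s (ρ - δ) with hs | hs
    · rw [e, cutProfile_of_le hδ hs, sub_self, abs_zero]; exact hb0
    · exact hmid (abs_le.2 ⟨by linarith, by linarith⟩)
  · have e : nearKernel ρ y z = 0 := by simp only [nearKernel, Set.indicator_of_notMem hz]
    rw [Metric.mem_ball, dist_comm, not_lt] at hz
    rcases le_total (ρ + δ) s with hs | hs
    · rw [e, cutProfile_of_ge hδ (by linarith), sub_self, abs_zero]; exact hb0
    · exact hmid (abs_le.2 ⟨by linarith, by linarith⟩)

end Profiles

/-! ### Partitions of unity and Riemann sums. -/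

section PartitionOfUnity

variable {X : Type*} [MetricSpace X] [CompactSpace X]

/-- Normalized tent functions on a finite cover. Positivity at the centre ensures positive mass for
measures of full support. -/
theorem exists_partition_of_unity (X : Type*) [MetricSpace X] [CompactSpace X] {r : ℝ}
    (hr : 0 < r) : ∃ (t : Finset X) (φ : t → C(X, ℝ)), (∀ i x, 0 ≤ φ i x) ∧ (∀ x, ∑ i, φ i x = 1) ∧
      (∀ i x, φ i x ≠ 0 → dist x i < r) ∧ ∀ i, 0 < φ i i := by
  obtain ⟨t, -, ht⟩ := (isCompact_univ (X := X)).elim_nhds_subcover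
    (fun x => Metric.ball x r) (fun x _ => Metric.ball_mem_nhds x hr)
  let θ : t → X → ℝ := fun i x => max 0 (r - dist x i)
  have hθ0 : ∀ i x, 0 ≤ θ i x := fun i x => le_max_left _ _
  have hS : ∀ x, 0 < ∑ i, θ i x := by
    intro x
    obtain ⟨z, hz, hxz⟩ := Set.mem_iUnion₂.1 (ht (Set.mem_univ x))
    refine Finset.sum_pos' (fun i _ => hθ0 i x) ⟨⟨z, hz⟩, Finset.mem_univ _, ?_⟩
    exact lt_max_of_lt_right (sub_pos.2 hxz)
  have hcont : ∀ i, Continuous (θ i) := fun i => by fun_prop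
  refine ⟨t, fun i => ⟨fun x => θ i x / ∑ j, θ j x, (hcont i).div
    (continuous_finsetSum _ fun j _ => hcont j) fun x => (hS x).ne'⟩, ?_, ?_, ?_, ?_⟩
  · exact fun i x => div_nonneg (hθ0 i x) (hS x).le
  · intro x
    simp only [ContinuousMap.coe_mk]
    rw [← Finset.sum_div, div_self (hS x).ne']
  · intro i x h
    by_contra! hlt
    refine h ?_
    have : θ i x = 0 := max_eq_left (by linarith)
    simp only [ContinuousMap.coe_mk, this, zero_div]
  · intro i
    refine div_pos (lt_max_of_lt_right ?_) (hS _)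
    rw [dist_self, sub_zero]
    exact hr

variable [MeasurableSpace X] [BorelSpace X]
  {Y : Type*} [MeasurableSpace Y] {ν : Measure Y} [IsFiniteMeasure ν] {f : Y → X}
  {t : Finset X} {φ : t → C(X, ℝ)} {r : ℝ}

/-- An integral is approximated by a Riemann sum along a partition of unity. -/
theorem abs_integral_comp_sub_sum_le (hf : Measurable f) (hφ0 : ∀ i x, 0 ≤ φ i x)
    (hφ1 : ∀ x, ∑ i, φ i x = 1) (hφr : ∀ i x, φ i x ≠ 0 → dist x i < r)
    {F : X → ℝ} (hF : Continuous F) {L : ℝ} (hL : ∀ x y, dist x y < r → |F x - F y| ≤ L) :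
    |∫ y, F (f y) ∂ν - ∑ i : t, F i * ∫ y, φ i (f y) ∂ν| ≤ L * ν.real Set.univ := by
  have hint : ∀ G : X → ℝ, Continuous G → Integrable (fun y => G (f y)) ν := by
    intro G hG
    obtain ⟨C, hC⟩ := isCompact_univ.exists_bound_of_continuousOn hG.continuousOn
    exact Integrable.of_bound (hG.measurable.comp hf).aestronglyMeasurable C
      (Eventually.of_forall fun y => hC _ (Set.mem_univ _))
  have e : ∫ y, F (f y) ∂ν - ∑ i : t, F i * ∫ y, φ i (f y) ∂ν =
      ∫ y, (F (f y) - ∑ i : t, F i * φ i (f y)) ∂ν := by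
    rw [integral_sub (hint F hF) (hint (fun x => ∑ i : t, F i * φ i x) (by fun_prop)),
      integral_finsetSum _ fun i _ => (hint (φ i) (φ i).continuous).const_mul _]
    simp only [integral_const_mul]
  rw [e, ← Real.norm_eq_abs]
  refine norm_integral_le_of_norm_le_const (Eventually.of_forall fun y => ?_)
  have e2 : F (f y) - ∑ i : t, F i * φ i (f y) = ∑ i : t, φ i (f y) * (F (f y) - F i) := by
    simp only [mul_sub, Finset.sum_sub_distrib, ← Finset.sum_mul, hφ1, one_mul, mul_comm (F _)]
  rw [e2]
  calc _ ≤ ∑ i : t, ‖φ i (f y) * (F (f y) - F i)‖ := norm_sum_le _ _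
    _ ≤ ∑ i : t, φ i (f y) * L := by
        refine Finset.sum_le_sum fun i _ => ?_
        by_cases h0 : φ i (f y) = 0
        · simp [h0]
        rw [norm_mul, Real.norm_of_nonneg (hφ0 i _), Real.norm_eq_abs]
        exact mul_le_mul_of_nonneg_left (hL _ _ (hφr i _ h0)) (hφ0 i _)
    _ = L := by rw [← Finset.sum_mul, hφ1, one_mul]

/-- The bound depends on `F` only through `L`, which makes weak convergence uniform over the
profiles centred at all points of `X`. -/
theorem abs_integral_comp_sub_integral_le (hf : Measurable f) {μ : Measure X} [IsFiniteMeasure μ]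
    (hφ0 : ∀ i x, 0 ≤ φ i x)
    (hφ1 : ∀ x, ∑ i, φ i x = 1) (hφr : ∀ i x, φ i x ≠ 0 → dist x i < r)
    {F : X → ℝ} (hF : Continuous F) (hF1 : ∀ x, |F x| ≤ 1) {L : ℝ}
    (hL : ∀ x y, dist x y < r → |F x - F y| ≤ L) :
    |∫ y, F (f y) ∂ν - ∫ x, F x ∂μ| ≤ L * (ν.real Set.univ + μ.real Set.univ) +
      ∑ i : t, |∫ y, φ i (f y) ∂ν - ∫ x, φ i x ∂μ| := by
  have h1 := abs_integral_comp_sub_sum_le (ν := ν) hf hφ0 hφ1 hφr hF hL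
  have h2 := abs_integral_comp_sub_sum_le (ν := μ) (f := id) measurable_id hφ0 hφ1 hφr hF hL
  simp only [id] at h2
  have h3 : |∑ i : t, F i * ∫ y, φ i (f y) ∂ν - ∑ i : t, F i * ∫ x, φ i x ∂μ| ≤
      ∑ i : t, |∫ y, φ i (f y) ∂ν - ∫ x, φ i x ∂μ| := by
    rw [← Finset.sum_sub_distrib]
    refine (Finset.abs_sum_le_sum_abs _ _).trans (Finset.sum_le_sum fun i _ => ?_)
    rw [← mul_sub, abs_mul]
    exact mul_le_of_le_one_left (abs_nonneg _) (hF1 i)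
  rw [abs_le] at *
  constructor <;> linarith

end PartitionOfUnity

/-! ### Uniform estimates from Bishop–Gromov. -/

section BishopGromovConsequences

variable {X : Type*} [MetricSpace X] [CompactSpace X] [MeasurableSpace X]
  {μ : Measure X} [IsFiniteMeasure μ] {Λ : ℝ}

/-- Compare with a ball of radius larger than the diameter, which is the whole space. -/
theorem BishopGromov.exists_pos_le_ball (h : BishopGromov μ Λ) (hμ : μ ≠ 0) {r : ℝ} (hr : 0 < r) :
    ∃ c : ℝ, 0 < c ∧ ∀ x, c ≤ μ.real (Metric.ball x r) := by
  have hμ' : 0 < μ.real Set.univ := by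
    rw [measureReal_def]
    exact ENNReal.toReal_pos (by simpa using hμ) (measure_ne_top _ _)
  set R := max r (Metric.diam (Set.univ : Set X) + 1)
  have hR : 0 < R / r := div_pos (hr.trans_le (le_max_left _ _)) hr
  refine ⟨μ.real Set.univ / (R / r) ^ Λ, by positivity, fun x => ?_⟩
  rw [div_le_iff₀ (by positivity), mul_comm]
  have e : Metric.ball x R = Set.univ := by
    refine Set.eq_univ_of_forall fun y => ?_
    rw [Metric.mem_ball]
    have := Metric.dist_le_diam_of_mem isCompact_univ.isBounded (Set.mem_univ y) (Set.mem_univ x)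
    have h2 : Metric.diam (Set.univ : Set X) + 1 ≤ R := le_max_right _ _
    linarith
  have := h x R r hr (le_max_left _ _)
  rwa [e] at this

variable [BorelSpace X]

theorem BishopGromov.isOpenPosMeasure (h : BishopGromov μ Λ) (hμ : μ ≠ 0) :
    μ.IsOpenPosMeasure := by
  refine ⟨fun U hU ⟨x, hx⟩ h0 => ?_⟩
  obtain ⟨r, hr, hball⟩ := Metric.isOpen_iff.1 hU x hx
  obtain ⟨c, hc, hcx⟩ := h.exists_pos_le_ball hμ hr
  have h1 : μ.real (Metric.ball x r) = 0 := by
    rw [measureReal_def, measure_mono_null hball h0, ENNReal.toReal_zero]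
  have := hcx x
  linarith

/-- The bump lives on the annulus between radii `ρ - 2 δ` and `ρ + 2 δ`, whose measure is at most
`((ρ + 2 δ) / (ρ - 2 δ)) ^ Λ - 1` times the total mass, uniformly in the centre. -/
theorem BishopGromov.exists_integral_bumpProfile_le (h : BishopGromov μ Λ) (hΛ : 0 ≤ Λ) {ρ : ℝ} (hρ : 0 < ρ)
    {η : ℝ} (hη : 0 < η) :
    ∃ δ : ℝ, 0 < δ ∧ ∀ x, ∫ y, bumpProfile ρ δ (dist x y) ∂μ ≤ η := by
  have hlim : Tendsto (fun δ : ℝ => (((ρ + 2 * δ) / (ρ - 2 * δ)) ^ Λ - 1) * μ.real Set.univ) (𝓝 0)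
      (𝓝 ((((ρ + 2 * 0) / (ρ - 2 * 0)) ^ Λ - 1) * μ.real Set.univ)) := by
    refine ContinuousAt.tendsto ?_
    refine ContinuousAt.mul (ContinuousAt.sub (ContinuousAt.rpow_const ?_ (Or.inl ?_))
      continuousAt_const) continuousAt_const
    · exact ContinuousAt.div (by fun_prop) (by fun_prop) (by simpa using hρ.ne')
    · simp [hρ.ne']
  rw [mul_zero, add_zero, sub_zero, div_self hρ.ne', Real.one_rpow, sub_self, zero_mul] at hlim
  have h1 : ∀ᶠ δ : ℝ in 𝓝[>] 0, (((ρ + 2 * δ) / (ρ - 2 * δ)) ^ Λ - 1) * μ.real Set.univ < η :=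
    (hlim.mono_left nhdsWithin_le_nhds).eventually (gt_mem_nhds hη)
  have h2 : ∀ᶠ δ : ℝ in 𝓝[>] 0, δ < ρ / 2 :=
    (tendsto_id.mono_left nhdsWithin_le_nhds).eventually (gt_mem_nhds (half_pos hρ))
  obtain ⟨δ, h1, h2, h3⟩ := (h1.and (h2.and self_mem_nhdsWithin)).exists
  have hδ : 0 < δ := h3
  refine ⟨δ, hδ, fun x => le_trans ?_ h1.le⟩
  have hsub : Metric.ball x (ρ - 2 * δ) ⊆ Metric.ball x (ρ + 2 * δ) :=
    Metric.ball_subset_ball (by linarith)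
  have hmeas : MeasurableSet (Metric.ball x (ρ + 2 * δ) \ Metric.ball x (ρ - 2 * δ)) :=
    Metric.isOpen_ball.measurableSet.diff Metric.isOpen_ball.measurableSet
  calc ∫ y, bumpProfile ρ δ (dist x y) ∂μ
      ≤ ∫ y, (Metric.ball x (ρ + 2 * δ) \ Metric.ball x (ρ - 2 * δ)).indicator 1 y ∂μ := by
        refine integral_mono_of_nonneg (Eventually.of_forall fun y => clampUnit_nonneg _)
          ((integrable_const (1 : ℝ)).indicator hmeas) (Eventually.of_forall fun y => ?_)
        by_cases hy : y ∈ Metric.ball x (ρ + 2 * δ) \ Metric.ball x (ρ - 2 * δ)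
        · rw [Set.indicator_of_mem hy]; exact clampUnit_le_one _
        · rw [Set.indicator_of_notMem hy]
          simp only
          refine (bumpProfile_of_le_abs_sub hδ ?_).le
          rw [Set.mem_sdiff, Metric.mem_ball, Metric.mem_ball, not_and_or, not_not, not_lt,
            dist_comm] at hy
          rw [le_abs]
          rcases hy with hy | hy
          · left; linarith
          · right; linarith
    _ = μ.real (Metric.ball x (ρ + 2 * δ)) - μ.real (Metric.ball x (ρ - 2 * δ)) := by
        rw [integral_indicator_one hmeas, measureReal_sdiff hsub Metric.isOpen_ball.measurableSet]
    _ ≤ (((ρ + 2 * δ) / (ρ - 2 * δ)) ^ Λ - 1) * μ.real (Metric.ball x (ρ - 2 * δ)) := by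
        have := h x (ρ + 2 * δ) (ρ - 2 * δ) (by linarith) (by linarith)
        linarith
    _ ≤ _ := by
        have h1 : 1 ≤ (ρ + 2 * δ) / (ρ - 2 * δ) := by
          rw [one_le_div (by linarith)]; linarith
        exact mul_le_mul_of_nonneg_left (measureReal_mono (Set.subset_univ _))
          (sub_nonneg.2 (Real.one_le_rpow h1 hΛ))

end BishopGromovConsequences

/-! ### Almost isometries yield a common discretization. -/

section Approximation

variable {X : Type*} [MetricSpace X] [CompactSpace X] [MeasurableSpace X] [BorelSpace X]
  {Y : Type*} [MetricSpace Y] [CompactSpace Y] [MeasurableSpace Y] [BorelSpace Y]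
  {ν : Measure Y} [IsFiniteMeasure ν] {f : Y → X} {t : Finset X} {φ : t → C(X, ℝ)}
  {ρ δ r ε : ℝ} {v : X → ℝ}

/-- The data `K` and `V` live on `X` alone, so the spaces mapped to `X` share them; `X` itself is
the case `f = id`. -/
theorem ballApprox_of_almost_isometry (hδ : 0 < δ) (hf : Measurable f)
    (hfd : ∀ y z, |dist (f y) (f z) - dist y z| ≤ δ)
    (hφ0 : ∀ i x, 0 ≤ φ i x) (hφ1 : ∀ x, ∑ i, φ i x = 1) (hφr : ∀ i x, φ i x ≠ 0 → dist x i < r)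
    (hr : 0 < r) (hrε : 2 * r / δ * ν.real Set.univ ≤ ε / 2)
    (hbump : ∀ x, ∫ y, bumpProfile ρ δ (dist x (f y)) ∂ν ≤ ε / 2)
    (hcut : ∀ x, |∫ y, cutProfile ρ δ (dist x (f y)) ∂ν - v x| ≤ ε / 4)
    (hv : ∀ x y, dist x y < r → |v x - v y| ≤ ε / 4) :
    BallApprox ν ρ ε (fun i j : t => cutProfile ρ δ (dist (i : X) j)) (fun i : t => v i)
      (fun i y => φ i (f y)) := by
  have hmeas : Measurable fun p : Y × Y => dist (f p.1) (f p.2) :=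
    (hf.comp measurable_fst).dist (hf.comp measurable_snd)
  have hfy : ∀ y, Measurable fun z => dist (f y) (f z) := fun y => measurable_const.dist hf
  have hint : ∀ (g : ℝ → ℝ), Measurable g → (∀ s, |g s| ≤ 1) → ∀ y,
      Integrable (fun z => g (dist (f y) (f z))) ν := fun g hg hg1 y =>
    Integrable.of_bound (hg.comp (hfy y)).aestronglyMeasurable 1 (Eventually.of_forall fun z => hg1 _)
  have hclamp : ∀ s, |clampUnit s| ≤ 1 := fun s => by
    rw [abs_of_nonneg (clampUnit_nonneg s)]; exact clampUnit_le_one s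
  have ib := hint _ (continuous_bumpProfile ρ δ).measurable fun s => hclamp _
  have ic := hint _ (continuous_cutProfile ρ δ).measurable fun s => hclamp _
  refine ⟨fun i => (φ i).continuous.measurable.comp hf, fun i y => hφ0 i _, fun y => hφ1 _, ?_, ?_⟩
  -- The bump pays for the jump and the distortion of `f`; `2 * r / δ` pays for moving both image
  -- points to the centres of their cells.
  · refine ⟨fun y z => bumpProfile ρ δ (dist (f y) (f z)) + 2 * r / δ, 1 + 2 * r / δ,
      ((continuous_bumpProfile ρ δ).measurable.comp hmeas).add_const _, fun y z =>
        add_nonneg (clampUnit_nonneg _) (by positivity), fun y z => by beta_reduce; rw [dist_comm],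
        fun y z => add_le_add_left (clampUnit_le_one _) _, fun y => ?_, fun i j y z hi hj => ?_⟩
    · rw [integral_add (ib y) (integrable_const _), integral_const, smul_eq_mul]
      have := hbump (f y)
      linarith
    · have h1 := abs_nearKernel_sub_cutProfile_le (ρ := ρ) hδ (hfd y z)
      have h2 := abs_cutProfile_sub_le ρ hδ (dist (f y) (f z)) (dist (i : X) j)
      have h3 : |dist (f y) (f z) - dist (i : X) j| / δ ≤ 2 * r / δ := by
        gcongr
        rw [← Real.dist_eq]
        refine (dist_dist_dist_le _ _ _ _).trans ?_
        linarith [hφr i _ hi, hφr j _ hj]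
      exact (abs_sub_le _ _ _).trans (add_le_add h1 (h2.trans h3))
  · intro i y hi
    have h1 : |ν.real (Metric.ball y ρ) - ∫ z, cutProfile ρ δ (dist (f y) (f z)) ∂ν| ≤ ε / 2 := by
      refine le_trans ?_ (hbump (f y))
      have in1 : Integrable (fun z => nearKernel ρ y z) ν :=
        Integrable.of_bound ((measurable_nearKernel ρ).comp measurable_prodMk_left).aestronglyMeasurable
          1 (Eventually.of_forall fun z => abs_nearKernel_le_one ρ y z)
      rw [← integral_nearKernel, ← integral_sub in1 (ic y), ← Real.norm_eq_abs]
      exact norm_integral_le_of_norm_le (ib y) (Eventually.of_forall fun z =>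
        abs_nearKernel_sub_cutProfile_le hδ (hfd y z))
    have h2 := hcut (f y)
    have h3 := hv _ _ (hφr i _ hi)
    rw [abs_le] at *
    constructor <;> linarith

end Approximation

/-! ### Transfer of form subspaces along a Fukaya convergent sequence. -/

section Fukaya

variable {Xs : ℕ → Type*} [∀ n, MetricSpace (Xs n)] [∀ n, CompactSpace (Xs n)]
  [∀ n, MeasurableSpace (Xs n)] [∀ n, BorelSpace (Xs n)]
  {μs : ∀ n, Measure (Xs n)} [∀ n, IsFiniteMeasure (μs n)]
  {X : Type*} [MetricSpace X] [CompactSpace X] [MeasurableSpace X] [BorelSpace X]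
  {μ : Measure X} [IsFiniteMeasure μ]

theorem exists_error_le {a b c : ℝ} (hba : b < a) (hc : 0 < c) :
    ∃ ε : ℝ, 0 < ε ∧ ε ≤ c ∧ ε ≤ 1 ∧
      b * ((1 + ε) * (1 + 2 * ε / c)) ≤ a - (2 + ε) * ε / c := by
  have h1 : Tendsto (fun ε : ℝ => a - (2 + ε) * ε / c - b * ((1 + ε) * (1 + 2 * ε / c))) (𝓝 0)
      (𝓝 (a - (2 + 0) * 0 / c - b * ((1 + 0) * (1 + 2 * 0 / c)))) :=
    Continuous.tendsto (by fun_prop) 0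
  have h2 : 0 < a - (2 + 0) * 0 / c - b * ((1 + 0) * (1 + 2 * 0 / c)) := by
    simpa using hba
  have h3 := (h1.mono_left (nhdsWithin_le_nhds (s := Set.Ioi 0))).eventually (lt_mem_nhds h2)
  have h4 : ∀ᶠ ε : ℝ in 𝓝[>] 0, ε < min c 1 :=
    (tendsto_id.mono_left nhdsWithin_le_nhds).eventually (gt_mem_nhds (lt_min hc one_pos))
  obtain ⟨ε, h5, h6, h7⟩ := (h3.and (h4.and self_mem_nhdsWithin)).exists
  exact ⟨ε, h7, h6.le.trans (min_le_left _ _), h6.le.trans (min_le_right _ _), by linarith⟩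

theorem FukayaConverges.eventually_hasFormSubspace (hconv : FukayaConverges μs μ)
    {Λ : ℝ} (hΛ : 0 ≤ Λ) (hBG : BishopGromov μ Λ) (hμ : μ ≠ 0) {ρ : ℝ} (hρ : 0 < ρ) (k : ℕ)
    {a b : ℝ} (hb : 0 < b) (hba : b < a) :
    ∀ᶠ n in atTop, (HasFormSubspace μ ρ k a → HasFormSubspace (μs n) ρ k b) ∧
      (HasFormSubspace (μs n) ρ k a → HasFormSubspace μ ρ k b) := by
  obtain ⟨σ, f, -, hσ, hfm, -, hfd, hweak⟩ := hconv
  have := hBG.isOpenPosMeasure hμ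
  obtain ⟨c, hc, hcμ⟩ := hBG.exists_pos_le_ball hμ hρ
  -- Volumes of ρ-balls in `Xs n` will be at least `c - 2 ε`, so `ε ≤ c / 4` leaves the bound `c /
  -- 4` for both spaces.
  obtain ⟨ε, hε, hεc, hε1, hab⟩ := exists_error_le hba (c := c / 4) (by positivity)
  obtain ⟨δ, hδ, hδμ⟩ := hBG.exists_integral_bumpProfile_le hΛ hρ (η := ε / 8) (by positivity)
  set M := μ.real Set.univ + 1 with hM
  -- `M` will also bound the mass of `Xs n` for large `n`, and `r` is chosen so that Riemann-sum
  -- errors total at most `ε / 8`.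
  have hMpos : 0 < M := add_pos_of_nonneg_of_pos measureReal_nonneg one_pos
  set r := ε * δ / (16 * M) with hrdef
  have hr : 0 < r := by positivity
  have hrM : r / δ * (2 * M) = ε / 8 := by rw [hrdef]; field_simp; norm_num
  have hrδ : 0 < r / δ := by positivity
  obtain ⟨t, φ, hφ0, hφ1, hφr, hφp⟩ := exists_partition_of_unity X hr
  have hmass : ∀ i : t, 0 < ∫ x, φ i x ∂μ := fun i => by
    have hi : Integrable (φ i) μ := (BoundedContinuousFunction.mkOfCompact (φ i)).integrable μ
    rw [integral_pos_iff_support_of_nonneg (hφ0 i) hi]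
    exact (φ i).continuous.isOpen_support.measure_pos μ ⟨i, (hφp i).ne'⟩
  have hlim : ∀ i : t, Tendsto (fun n => ∫ y, φ i (f n y) ∂μs n) atTop (𝓝 (∫ x, φ i x ∂μ)) := by
    intro i
    have := (FiniteMeasure.tendsto_iff_forall_integral_tendsto.1 hweak)
      (BoundedContinuousFunction.mkOfCompact (φ i))
    refine this.congr fun n => ?_
    exact integral_map (hfm n).aemeasurable (φ i).continuous.aestronglyMeasurable
  have hsum : Tendsto (fun n => ∑ i : t, |∫ y, φ i (f n y) ∂μs n - ∫ x, φ i x ∂μ|) atTop (𝓝 0) := by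
    have : Tendsto (fun n => ∑ i : t, |∫ y, φ i (f n y) ∂μs n - ∫ x, φ i x ∂μ|) atTop
        (𝓝 (∑ i : t, |∫ x, φ i x ∂μ - ∫ x, φ i x ∂μ|)) :=
      tendsto_finsetSum _ fun i _ => ((hlim i).sub tendsto_const_nhds).abs
    simpa using this
  have hlt1 : ∀ i : t, ∫ x, φ i x ∂μ < (1 + ε) * ∫ x, φ i x ∂μ := fun i => by
    nlinarith [mul_pos hε (hmass i)]
  have hev1 : ∀ᶠ n in atTop, ∀ i : t, ∫ y, φ i (f n y) ∂μs n < (1 + ε) * ∫ x, φ i x ∂μ :=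
    eventually_all.2 fun i => (hlim i).eventually (gt_mem_nhds (hlt1 i))
  have hev2 : ∀ᶠ n in atTop, ∀ i : t, ∫ x, φ i x ∂μ < (1 + ε) * ∫ y, φ i (f n y) ∂μs n :=
    eventually_all.2 fun i => ((hlim i).const_mul (1 + ε)).eventually (lt_mem_nhds (hlt1 i))
  have hclamp : ∀ s, |clampUnit s| ≤ 1 := fun s => by
    rw [abs_of_nonneg (clampUnit_nonneg s)]; exact clampUnit_le_one s
  have hLip : ∀ g : ℝ → ℝ, (∀ s s', |g s - g s'| ≤ |s - s'| / δ) → ∀ x y z : X, dist y z < r →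
      |g (dist x y) - g (dist x z)| ≤ r / δ := by
    intro g hg x y z hyz
    refine (hg _ _).trans ?_
    gcongr
    rw [← Real.dist_eq]
    refine (dist_dist_dist_le_right _ _ _).trans hyz.le
  have hbL := hLip _ (abs_bumpProfile_sub_le ρ hδ)
  have hcL := hLip _ (abs_cutProfile_sub_le ρ hδ)
  set v : X → ℝ := fun x => ∫ z, cutProfile ρ δ (dist x z) ∂μ with hvdef
  have hv : ∀ x y, dist x y < r → |v x - v y| ≤ ε / 4 := by
    intro x y hxy
    have hi : ∀ x, Integrable (fun z => cutProfile ρ δ (dist x z)) μ := fun x =>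
      Integrable.of_bound ((continuous_cutProfile ρ δ).comp (by fun_prop)).aestronglyMeasurable 1
        (Eventually.of_forall fun z => hclamp _)
    rw [hvdef]
    simp only
    rw [← integral_sub (hi x) (hi y), ← Real.norm_eq_abs]
    refine (norm_integral_le_of_norm_le_const (C := r / δ) (Eventually.of_forall fun z => ?_)).trans ?_
    · rw [dist_comm x z, dist_comm y z]
      exact hcL z x y hxy
    · have : r / δ * μ.real Set.univ ≤ r / δ * (2 * M) := by
        gcongr
        have : 0 ≤ μ.real Set.univ := measureReal_nonneg
        linarith
      linarith
  have hV : ∀ i : t, 0 ≤ v i := fun i => integral_nonneg fun z => clampUnit_nonneg _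
  have hμM : μ.real Set.univ ≤ M := by linarith
  have hX : BallApprox μ ρ ε (fun i j : t => cutProfile ρ δ (dist (i : X) j)) (fun i : t => v i)
      (fun i x => φ i x) := by
    refine ballApprox_of_almost_isometry (f := id) hδ measurable_id (fun y z => ?_) hφ0 hφ1 hφr hr
      ?_ (fun x => ?_) (fun x => ?_) hv
    · simpa using hδ.le
    · have : r / δ * μ.real Set.univ ≤ r / δ * M := by gcongr
      have : 2 * r / δ * μ.real Set.univ = 2 * (r / δ * μ.real Set.univ) := by ring
      linarith
    · exact (hδμ x).trans (by linarith)
    · simp only [id, hvdef, sub_self, abs_zero]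
      positivity
  filter_upwards [hσ.eventually (gt_mem_nhds hδ), hev1, hev2,
    hsum.eventually (gt_mem_nhds (show (0 : ℝ) < ε / 8 by positivity))] with n hσn hn1 hn2 hns
  have hνM : (μs n).real Set.univ ≤ M := by
    have hone : ∀ x y : X, dist x y < r → |(1 : ℝ) - 1| ≤ 0 := fun _ _ _ => by simp
    have h1 := abs_integral_comp_sub_integral_le (ν := μs n) (μ := μ) (F := fun _ => 1) (hfm n) hφ0 hφ1 hφr
      continuous_const (by simp) hone
    simp only [integral_const, smul_eq_mul, mul_one, zero_mul, zero_add] at h1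
    have := (abs_le.1 h1).2
    linarith
  have hr2 : r / δ * ((μs n).real Set.univ + μ.real Set.univ) ≤ ε / 8 := by
    rw [← hrM]
    gcongr
    linarith
  have hXn : BallApprox (μs n) ρ ε (fun i j : t => cutProfile ρ δ (dist (i : X) j))
      (fun i : t => v i) (fun i y => φ i (f n y)) := by
    refine ballApprox_of_almost_isometry hδ (hfm n) (fun y z => (hfd n y z).le.trans hσn.le) hφ0 hφ1
      hφr hr ?_ (fun x => ?_) (fun x => ?_) hv
    · have : r / δ * (μs n).real Set.univ ≤ r / δ * M := by gcongr
      have : 2 * r / δ * (μs n).real Set.univ = 2 * (r / δ * (μs n).real Set.univ) := by ring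
      linarith
    -- Three errors of `ε / 8` each: the annulus in `X`, the Riemann sums, and weak convergence.
    · have h1 := abs_integral_comp_sub_integral_le (ν := μs n) (μ := μ) (hfm n) hφ0 hφ1 hφr
        (F := fun z => bumpProfile ρ δ (dist x z))
        ((continuous_bumpProfile ρ δ).comp (by fun_prop)) (fun z => hclamp _) (hbL x)
      have := (abs_le.1 h1).2
      have := hδμ x
      linarith
    · have h1 := abs_integral_comp_sub_integral_le (ν := μs n) (μ := μ) (hfm n) hφ0 hφ1 hφr
        (F := fun z => cutProfile ρ δ (dist x z))
        ((continuous_cutProfile ρ δ).comp (by fun_prop)) (fun z => hclamp _) (hcL x)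
      exact h1.trans (by linarith)
  have hVc : ∀ i : t, c - ε ≤ v i := fun i => by
    have h1 := (abs_le.1 (hX.volume i i (hφp i).ne')).2
    have := hcμ i
    linarith
  have hcν : ∀ y, c / 4 ≤ (μs n).real (Metric.ball y ρ) := by
    intro y
    obtain ⟨i, -, hi⟩ := Finset.exists_ne_zero_of_sum_ne_zero
      (show ∑ i, φ i (f n y) ≠ 0 by rw [hφ1]; exact one_ne_zero)
    have h1 := (abs_le.1 (hXn.volume i y hi)).1
    have := hVc i
    linarith
  exact ⟨fun h => h.transport hX hXn hε.le hV (fun i => (hn2 i).le) (by positivity)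
      (fun y => le_trans (by linarith) (hcμ y)) hb hab,
    fun h => h.transport hXn hX hε.le hV (fun i => (hn1 i).le) (by positivity) hcν hb hab⟩

end Fukaya

end

/-- `λ_k` of the `ρ`-Laplacian is stable under Fukaya convergence to a length space satisfying a
Bishop--Gromov type inequality. -/
theorem theorem1p1
    {Xs : ℕ → Type*} [∀ n, MetricSpace (Xs n)] [∀ n, CompactSpace (Xs n)]
    [∀ n, MeasurableSpace (Xs n)] [∀ n, BorelSpace (Xs n)]
    (μs : ∀ n, Measure (Xs n)) [∀ n, IsFiniteMeasure (μs n)]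
    {X : Type*} [MetricSpace X] [CompactSpace X] [MeasurableSpace X] [BorelSpace X]
    (μ : Measure X) [IsFiniteMeasure μ]
    (hconv : FukayaConverges μs μ)
    (hlength : IsLengthMetric X)
    (hBG : ∃ Λ : ℝ, 0 < Λ ∧ BishopGromov μ Λ)
    (ρ : ℝ) (hρ : 0 < ρ) (k : ℕ) (hk : 1 ≤ k)
    (hlt : mmLambda μ ρ k < (((ρ ^ 2)⁻¹ : ℝ) : EReal)) :
    Tendsto (fun n => mmLambda (μs n) ρ k) atTop (𝓝 (mmLambda μ ρ k)) := by
  obtain ⟨Λ, hΛ, hBG⟩ := hBG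
  have hρ2 : 0 < ρ ^ 2 := by positivity
  have hscale : ∀ s : ℝ, (ρ ^ 2)⁻¹ * (1 - (1 - ρ ^ 2 * s)) = s := fun s => by
    rw [sub_sub_cancel, inv_mul_cancel_left₀ hρ2.ne']
  have hpos : ∀ s : ℝ, s < (ρ ^ 2)⁻¹ → 0 < 1 - ρ ^ 2 * s := fun s hs => by
    have := mul_lt_mul_of_pos_left hs hρ2
    rw [mul_inv_cancel₀ hρ2.ne'] at this
    linarith
  have hanti : ∀ s s' : ℝ, s < s' → 1 - ρ ^ 2 * s' < 1 - ρ ^ 2 * s := fun s s' h => by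
    have := mul_lt_mul_of_pos_left h hρ2
    linarith
  -- For `μ = 0` the space L² is trivial and has no subspace of dimension `k ≥ 1`, so `hlt` fails.
  have hμ : μ ≠ 0 := by
    rintro rfl
    obtain ⟨t, ht, ht'⟩ := EReal.lt_iff_exists_real_btwn.1 hlt
    obtain ⟨W, hW, -⟩ := hasFormSubspace_of_mmLambda_lt (0 : Measure X) hρ
      (EReal.coe_lt_coe_iff.1 ht').le ht
    have hsub : Subsingleton (Lp ℝ 2 (0 : Measure X)) :=
      ⟨fun u v => Lp.ext (by simp [Filter.EventuallyEq])⟩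
    have : Module.finrank ℝ W = 0 := Module.finrank_zero_of_subsingleton
    omega
  refine tendsto_order.2 ⟨fun l hl => ?_, fun l hl => ?_⟩
  -- Lower bound, with `l < s < s₁ < s₂ < s₃ < λ_k(X)`: if `λ_k(Xs n) ≤ l`, a subspace at level `s₁`
  -- moves to `X` at level `s₂` and yields `λ_k(X) ≤ s₃`.
  · obtain ⟨s, hls, hs⟩ := EReal.lt_iff_exists_real_btwn.1 hl
    obtain ⟨s₁, hss₁, hs₁⟩ := EReal.lt_iff_exists_real_btwn.1 hs
    obtain ⟨s₂, hss₂, hs₂⟩ := EReal.lt_iff_exists_real_btwn.1 hs₁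
    have h2 : s₂ < (ρ ^ 2)⁻¹ := EReal.coe_lt_coe_iff.1 (hs₂.trans hlt)
    have h12 := EReal.coe_lt_coe_iff.1 hss₂
    have h01 := EReal.coe_lt_coe_iff.1 hss₁
    obtain ⟨s₃, hss₃, hs₃⟩ := EReal.lt_iff_exists_real_btwn.1 hs₂
    have h23 := EReal.coe_lt_coe_iff.1 hss₃
    have h3 : s₃ < (ρ ^ 2)⁻¹ := EReal.coe_lt_coe_iff.1 (hs₃.trans hlt)
    filter_upwards [hconv.eventually_hasFormSubspace hΛ.le hBG hμ hρ k (hpos s₂ h2)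
      (hanti _ _ h12)] with n hn
    by_contra! hcon
    have hsub := hasFormSubspace_of_mmLambda_lt (μs n) hρ (h12.trans h2).le
      (hcon.trans_lt (hls.trans hss₁))
    have := (hn.2 hsub).mmLambda_le hρ hk (hpos s₃ h3) (hanti _ _ h23)
    rw [hscale] at this
    exact absurd this (not_le.2 hs₃)
  -- Upper bound: the subspace of `X` at level `s` moves to `Xs n` at level `s₁` and yields `λ_k(Xs
  -- n) ≤ s₂ < l`. Staying below ρ⁻² keeps the form constants positive.
  · obtain ⟨s, hls, hs⟩ := EReal.lt_iff_exists_real_btwn.1 (lt_min hl hlt)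
    obtain ⟨s₁, hss₁, hs₁⟩ := EReal.lt_iff_exists_real_btwn.1 hs
    obtain ⟨s₂, hss₂, hs₂⟩ := EReal.lt_iff_exists_real_btwn.1 hs₁
    have h01 := EReal.coe_lt_coe_iff.1 hss₁
    have h12 := EReal.coe_lt_coe_iff.1 hss₂
    have h2 : s₂ < (ρ ^ 2)⁻¹ := EReal.coe_lt_coe_iff.1 (hs₂.trans_le (min_le_right _ _))
    have hsub := hasFormSubspace_of_mmLambda_lt μ hρ ((h01.trans h12).trans h2).le hls
    filter_upwards [hconv.eventually_hasFormSubspace hΛ.le hBG hμ hρ k (hpos s₁ (h12.trans h2))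
      (hanti _ _ h01)] with n hn
    have := (hn.1 hsub).mmLambda_le hρ hk (hpos s₂ h2) (hanti _ _ h12)
    rw [hscale] at this
    exact this.trans_lt (hs₂.trans_le (min_le_left _ _))
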